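/- **Setting.** Order $\{0,1\}^n$ coordinatewise. The Möbius transform of $f:\{0,1\}^n\to\mathbb R$ is $F(k)=\sum_{m\le k}(-1)^{|k-m|}f(m)$. Say that $f$ has *no cancellation* if no nonempty set of nonzero Möbius coefficients of $f$ sums to $0$ (for instance, the nonzero coefficients are positive, or generic reals). Boolean matrix products use logical OR as addition, and $\bar x$ is the bitwise complement. **Algorithm (Sparse Möbius Transform, $C=3$, $D_c=I$).** Given injections $I_c:\{1,\dots,b\}\to\{1,\dots,n\}$, $c=1,2,3$, with pairwise disjoint ranges, let $H_c$ be the $b\times n$ matrix whose $j$-th row is the unit vector $e_{I_c(j)}$. Put $d_0=0$ and $d_p=e_p$ for $1\le p\le n$. Sample $u_{c,p}(\ell)=f(\overline{H_c^T\bar\ell+d_p})$ for all $\ell\in\{0,1\}^b$ and compute the Möbius transforms $U_{c,p}$ of all $u_{c,p}$. The vector $U_c(j)=(U_{c,0}(j),\dots,U_{c,n}(j))$ is called a bin. With $y_p=1-U_{c,p}(j)/U_{c,0}(j)$, a bin is declared a *zeroton* if it is the zero vector; a *singleton* with location $k=y$ and value $v=U_{c,0}(j)$ if $U_{c,0}(j)\neq0$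 and $y\in\{0,1\}^n$; and a *multiton* otherwise. Start from $\hat F=0$ with no location known. While there are bins declared singletons, go through them: if its location $k$ is not yet known, mark $k$ as known, set $\hat F(k)=v$, and for every $c'$ subtract $v\,(1-d_p^Tk)$ from $U_{c',p}(H_{c'}k)$ for $p=0,\dots,n$; then repeat the type estimation. Output $\hat F$. Running time counts real arithmetic operations and comparisons, Boolean operations, samples and memory operations as unit steps, a table indexed by $\{0,1\}^s$ being a binary tree whose cells are read or written in $s+1$ steps; after an iteration, type estimation is repeated only for the bins declared singletons before it and the bins that were changed. **Theorem.** There are absolute constants $\eta_0,B_0>0$ such that for every $\eta_1\ge2\eta_0$ there is a constant $c>0$ with the following property. Let $\delta\le\frac13$ and $B\in\mathbb R$, where $B\le B_0$ if $\delta=\frac13$. Then for all sufficiently large $n$ and all $K\ge1$ with $K\le B\,2^{n\delta}$: 1. there is $b$ with $\eta_0K\le2^b\le\eta_1K$ and $3b\le n$ (so that disjoint coordinate sets of size $b=O(\log K)$ exist); 2. for every $b$ with $\eta_0K\le 2^b\le\eta_1K$ and all $I_1,I_2,I_3$ as above, if $k_1,\dots,k_K$ are distinct points of $\{0,1\}^n$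 chosen uniformly at random, then with probability at least $1-c/K$ the following holds: for every $f$ without cancellation whose Möbius coefficients are nonzero exactly at $k_1,\dots,k_K$, the algorithm terminates with $\hat F=F$ after at most $cKn$ samples and at most $cKn^2$ steps; 3. if moreover $\delta\le\frac16$, cancellation may be allowed when the values do not depend on the locations: for arbitrary fixed nonzero reals $v_1,\dots,v_K$, with probability at least $1-c/K$ over $k_1,\dots,k_K$ the algorithm, run on the function $f$ with $F(k_i)=v_i$ and $F=0$ elsewhere, terminates with $\hat F=F$ after at most $cKn$ samples and at most $cKn^2$ steps. -/

import Mathlib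

noncomputable section

namespace SparseMobius

/-! ### The Möbius transform of a function on the Boolean cube -/

/-- The Boolean cube `{0,1}^n`, with the coordinatewise order. -/
abbrev Cube (n : ℕ) : Type := Fin n → Bool

/-- The Möbius transform `F(k) = ∑_{m ≤ k} (-1)^{|k - m|} f(m)`. -/
def mobius {n : ℕ} (f : Cube n → ℝ) (k : Cube n) : ℝ :=
  ∑ m : Cube n,
    if ∀ i, m i ≤ k i then (-1 : ℝ) ^ (Finset.univ.filter fun i => k i = true ∧ m i = false).card * f m
    else 0

/-- No nonempty set of nonzero Möbius coefficients of `f` sums to zero. -/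
def NoCancellation {n : ℕ} (f : Cube n → ℝ) : Prop :=
  ∀ A : Finset (Cube n), A.Nonempty → (∀ k ∈ A, mobius f k ≠ 0) → ∑ k ∈ A, mobius f k ≠ 0

/-! ### Programs with a step count and a sample count

A program accesses the unknown function `f` only through `query`. Every elementary operation
(an arithmetic operation or comparison of real numbers, a Boolean operation, forming one cell of a
list, of a vector or of a binary tree) is one `step`. A table indexed by `{0,1}^s` is a binary
tree of depth `s`: joining two such tables is one step, while reading or writing the cell at a
given address takes `s + 1` steps. -/

/-- Programs with oracle access to a real function on `{0,1}^n`. -/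
inductive Prog (n : ℕ) (α : Type) : Type
  | ret (a : α) : Prog n α
  | step (p : Prog n α) : Prog n α
  | query (m : Cube n) (k : ℝ → Prog n α) : Prog n α

namespace Prog

variable {n : ℕ} {α β : Type}

/-- Sequential composition. -/
def bind : Prog n α → (α → Prog n β) → Prog n β
  | ret a, g => g a
  | step p, g => step (p.bind g)
  | query m k, g => query m fun x => (k x).bind g

instance : Monad (Prog n) where
  pure := ret
  bind := bind

/-- The value returned when the oracle is `f`. -/
def output (f : Cube n → ℝ) : Prog n α → α
  | ret a => a
  | step p => p.output f
  | query m k => (k (f m)).output f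

/-- The running time: elementary steps, a query counting as one step. -/
def steps (f : Cube n → ℝ) : Prog n α → ℕ
  | ret _ => 0
  | step p => p.steps f + 1
  | query m k => (k (f m)).steps f + 1

/-- The number of samples of `f` that are taken. -/
def samples (f : Cube n → ℝ) : Prog n α → ℕ
  | ret _ => 0
  | step p => p.samples f
  | query m k => (k (f m)).samples f + 1

/-- One elementary operation with result `a`. -/
def op (a : α) : Prog n α := step (ret a)

/-- `t` elementary steps with result `a`. -/
def charge (a : α) : ℕ → Prog n α
  | 0 => ret a
  | t + 1 => step (charge a t)

/-- Take one sample of `f`. -/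
def sample (m : Cube n) : Prog n ℝ := query m ret

/-- Compute the entries of a vector one after the other. -/
def tabulate : (m : ℕ) → (Fin m → Prog n α) → Prog n (Fin m → α)
  | 0, _ => ret Fin.elim0
  | m + 1, g => do
    let a ← g 0
    let t ← tabulate m fun i => g i.succ
    op (Fin.cons a t)

/-- `for i = 0, …, m - 1 do x ← g i x`. -/
def forFin : (m : ℕ) → (Fin m → β → Prog n β) → β → Prog n β
  | 0, _, x => ret x
  | m + 1, g, x => do
    let y ← step (g 0 x)
    forFin m (fun i => g i.succ) y

/-- `for a in l do x ← g a x`. -/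
def forList : List α → (α → β → Prog n β) → β → Prog n β
  | [], _, x => ret x
  | a :: l, g, x => do
    let y ← step (g a x)
    forList l g y

/-- The table on `{0,1}^(s+1)` made of two tables on `{0,1}^s`, split by the first bit. -/
def join {s : ℕ} (t₀ t₁ : Cube s → α) : Cube (s + 1) → α :=
  fun x => if x 0 then t₁ (Fin.tail x) else t₀ (Fin.tail x)

/-- Compute the entries of a table on `{0,1}^s` one after the other. -/
def tabulateCube : (s : ℕ) → (Cube s → Prog n α) → Prog n (Cube s → α)
  | 0, g => do
    let a ← g Fin.elim0
    op fun _ => a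
  | s + 1, g => do
    let t₀ ← tabulateCube s fun x => g (Fin.cons false x)
    let t₁ ← tabulateCube s fun x => g (Fin.cons true x)
    op (join t₀ t₁)

/-- `for x in {0,1}^s do y ← g x y`. -/
def forCube : (s : ℕ) → (Cube s → β → Prog n β) → β → Prog n β
  | 0, g, y => step (g Fin.elim0 y)
  | s + 1, g, y => do
    let z ← step (forCube s (fun x => g (Fin.cons false x)) y)
    forCube s (fun x => g (Fin.cons true x)) z

/-- Read the cell of a table at address `x`. -/
def readAt {s : ℕ} (T : Cube s → α) (x : Cube s) : Prog n α := charge (T x) (s + 1)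

/-- Write `a` into the cell of a table at address `x`. -/
def writeAt {s : ℕ} (T : Cube s → α) (x : Cube s) (a : α) : Prog n (Cube s → α) :=
  charge (Function.update T x a) (s + 1)

end Prog

open Prog

/-! ### The Sparse Möbius Transform -/

/-- A Boolean matrix with `r` rows and `s` columns. -/
abbrev BMatrix (r s : ℕ) : Type := Fin r → Fin s → Bool

/-- The matrix whose `j`-th row is the unit vector of the coordinate `I j`. -/
def coordMatrix {b n : ℕ} (I : Fin b → Fin n) : BMatrix b n := fun j i => decide (I j = i)

/-- The identity matrix. -/
def idMatrix (n : ℕ) : BMatrix n n := fun p i => decide (p = i)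

/-- The Boolean product `A x`, in which addition is the logical OR. -/
def mulVec {n r s : ℕ} (A : BMatrix r s) (x : Cube s) : Prog n (Cube r) :=
  tabulate r fun i => forFin s (fun j acc => op (acc || (A i j && x j))) false

/-- Divide-and-conquer computation of the Möbius transform of a function on `{0,1}^s`. -/
def fastMobius {n : ℕ} : (s : ℕ) → (Cube s → ℝ) → Prog n (Cube s → ℝ)
  | 0, u => op u
  | s + 1, u => do
    let l ← fastMobius s fun x => u (Fin.cons false x)
    let r ← fastMobius s fun x => u (Fin.cons true x)
    let d ← tabulateCube s fun x => op (r x - l x)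
    op (join l d)

/-- The transforms `U_{c,p}` of the subsampled functions `u_{c,p}(ℓ) = f(¬(Hᵀ ¬ℓ + d_p))`, for one
group `c`; here `d_0 = 0`, and `d_1, …, d_P` are the rows of `D`. -/
def subsample {n b P : ℕ} (H : BMatrix b n) (D : BMatrix P n) :
    Prog n (Fin (P + 1) → Cube b → ℝ) := do
  let base ← tabulateCube b fun l => do
    let nl ← tabulate b fun i => op (!(l i))
    mulVec (fun i j => H j i) nl
  let d : BMatrix (P + 1) n := Fin.cons (fun _ => false) D
  tabulate (P + 1) fun p => do
    let u ← tabulateCube b fun l => do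
      let m ← tabulate n fun i => op (!(base l i || d p i))
      sample m
    fastMobius b u

/-- The possible types of a bin. -/
inductive BinType (n : ℕ) : Type
  | zeroton : BinType n
  | multiton : BinType n
  | singleton (k : Cube n) (v : ℝ) : BinType n

/-- Type estimation from the vector `(U_{c,0}(j), …, U_{c,P}(j))`, through the ratios
`y_p = 1 - U_{c,p}(j) / U_{c,0}(j)`. A nonzero vector whose ratios are undefined is reported as a
multiton. `dec` recovers `k` from the bits `y = D k`. -/
def detect {n P : ℕ} (dec : Cube P → Prog n (Cube n)) (u : Fin (P + 1) → ℝ) :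
    Prog n (BinType n) := do
  let z ← forFin (P + 1) (fun p acc => op (acc && decide (u p = 0))) true
  if z then
    op BinType.zeroton
  else do
    let z₀ ← op (decide (u 0 = 0))
    if z₀ then
      op BinType.multiton
    else do
      let y ← tabulate P fun p => do
        let q ← op (u p.succ / u 0)
        op (1 - q)
      let ok ← forFin P (fun p acc => op (acc && (decide (y p = 0) || decide (y p = 1)))) true
      if ok then do
        let bits ← tabulate P fun p => op (decide (y p = 1))
        let k ← dec bits
        op (BinType.singleton k (u 0))
      else
        op BinType.multiton

/-- A bin: a group `c` and an address `j`. -/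
abbrev Bin (C b : ℕ) : Type := Fin C × Cube b

/-- A bin that was detected as a singleton, with its location and its value. -/
abbrev Entry (C b n : ℕ) : Type := Bin C b × Cube n × ℝ

/-- The contents `U_{c,p}(j)` of all bins. -/
abbrev Bins (C b P : ℕ) : Type := Fin C → Fin (P + 1) → Cube b → ℝ

/-- The variables of the main loop: the bins, the estimate `F̂`, and the set of known locations. -/
structure State (C b P n : ℕ) : Type where
  bins : Bins C b P
  estimate : Cube n → ℝ
  known : Cube n → Bool

section Algorithm

variable {C b P n : ℕ} (H : Fin C → BMatrix b n) (D : Fin C → BMatrix P n)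
  (dec : Fin C → Cube P → Prog n (Cube n))

/-- Run the type estimation on one bin; if it is a singleton, add it to the list `S`. -/
def scan (U : Bins C b P) (x : Bin C b) (S : List (Entry C b n)) :
    Prog n (List (Entry C b n)) := do
  let u ← tabulate (P + 1) fun p => readAt (U x.1 p) x.2
  let t ← detect (dec x.1) u
  match t with
  | BinType.singleton k v => op ((x, k, v) :: S)
  | _ => op S

/-- Subtract `v (1 - D_c k)` from the bin of `k` in every group `c` (its first entry, which belongs
to `d_0 = 0`, becomes `U_{c,0} - v`), and add these bins to the list `T` of touched bins. -/
def subtract (k : Cube n) (v : ℝ) (U : Bins C b P) (T : List (Bin C b)) :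
    Prog n (Bins C b P × List (Bin C b)) :=
  forFin C (fun c UT => do
    let j ← mulVec (H c) k
    let e ← mulVec (D c) k
    let e' : Fin (P + 1) → Bool := Fin.cons false e
    let Uc ← forFin (P + 1) (fun p Uc => do
      let a ← readAt (Uc p) j
      let w ← op (v * (1 - if e' p then 1 else 0))
      let r ← op (a - w)
      let t ← writeAt (Uc p) j r
      op (Function.update Uc p t)) (UT.1 c)
    op (Function.update UT.1 c Uc, (c, j) :: UT.2)) (U, T)

/-- Process one entry of `S`: if its location is not yet known, record it and subtract it from
its bins. The bin of the entry and all bins that are changed are added to the touched bins. -/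
def process (x : Entry C b n) (sT : State C b P n × List (Bin C b)) :
    Prog n (State C b P n × List (Bin C b)) := do
  let old ← readAt sT.1.known x.2.1
  if old then
    op (sT.1, x.1 :: sT.2)
  else do
    let est ← writeAt sT.1.estimate x.2.1 x.2.2
    let known ← writeAt sT.1.known x.2.1 true
    let UT ← subtract H D x.2.1 x.2.2 sT.1.bins (x.1 :: sT.2)
    op (⟨UT.1, est, known⟩, UT.2)

/-- The main loop, run until `S` is empty, or until the given number of iterations is used up,
in which case nothing is returned. After an iteration only the touched bins are examined again:
every other bin is unchanged and was not a singleton. -/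
def mainLoop : ℕ → State C b P n → List (Entry C b n) → Prog n (Option (Cube n → ℝ))
  | 0, _, _ => ret none
  | _ + 1, s, [] => op (some s.estimate)
  | t + 1, s, x :: S => do
    let sT ← forList (x :: S) (process H D) (s, [])
    let S' ← forList sT.2 (scan dec sT.1.bins) []
    step (mainLoop t sT.1 S')

/-- The Sparse Möbius Transform with subsampling matrices `H_c`, delay matrices `D_c` and decoders
`dec_c` of `k` from `D_c k`, its main loop being cut off after `t` iterations. -/
def smt (t : ℕ) : Prog n (Option (Cube n → ℝ)) := do
  let U ← tabulate C fun c => subsample (H c) (D c)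
  let S ← forFin C (fun c S => forCube b (fun j S => scan dec U (c, j) S) S) []
  mainLoop H D dec t ⟨U, fun _ => 0, fun _ => false⟩ S

end Algorithm

/-- The Sparse Möbius Transform with the coordinate-subsampling matrices given by `I` and with
`D_c` the identity (so that `k = y`), run on `f`, terminates with the exact Möbius transform of `f`
after at most `T` steps and at most `Q` samples. -/
def Recovers {C b n : ℕ} (I : Fin C → Fin b ↪ Fin n) (f : Cube n → ℝ) (Q T : ℝ) : Prop :=
  ∃ t : ℕ,
    let p := smt (fun c => coordMatrix (I c)) (fun _ => idMatrix n) (fun _ y => ret y) t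
    p.output f = some (mobius f) ∧ (p.samples f : ℝ) ≤ Q ∧ (p.steps f : ℝ) ≤ T

/-- The probability of the event `E` when `(k_1, …, k_K)` is a uniformly random `K`-tuple of
distinct points of `{0,1}^n`. -/
def prob {K n : ℕ} (E : (Fin K ↪ Cube n) → Prop) : ℝ :=
  (Nat.card {κ : Fin K ↪ Cube n // E κ} : ℝ) / Nat.card (Fin K ↪ Cube n)

end SparseMobius

end

/-!
Peeling singletons is the 2-core process on the 3-partite hypergraph whose vertices are the bins and
whose edges are the nonzero Möbius coefficients, each joined to its bin in the three groups.

*Deterministic part.* By Möbius inversion, the bin `j` of the group `c` holds the sums of `F k` over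
the `k` with `k ∘ I c = j` and `d_p^T k = 0` (`Ends.subsample`). A bin with exactly one remaining
coefficient always passes the singleton test. If no bin with two or more does (`Unambiguous`), then
the algorithm peels exactly the true singletons, and it stops with the exact transform as soon as
every nonempty set of coefficients has a member that is alone in one of its bins (`Peelable`). Calling
a crowded bin a zeroton or a multiton makes no difference, so cancellation inside a bin is harmless
by itself. A pass over the singletons empties their bins, so that new singletons arise only in the
at most three bins of each newly known location; hence the number of type estimations, each of cost
`O(n²)`, is linear in the number of bins and coefficients (`Ends.mainLoop`, `Ends.smt`).

*Cores.* If peeling gets stuck, some `s ≥ 2` coefficients occupy at most `s / 2` bins of each group.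
For `2^b ≥ 18 K` a union bound over these coefficients and bins gives at most `s 2^{-s} / (36 K)` for
each `s`, and the sum over `s` is `O(1 / K)` (`card_exists_isCore_le`).

*False singletons.* Without cancellation there are none: if all ratios are `0` or `1`, all points of
the bin agree in every coordinate. In general, a set of `a ≥ 2` points shares a bin of a given group
with probability `2^{-b (a - 1)}`, and then each of the `n - b` coordinates that do not address this
group gives a ratio in `{0, 1}` with probability at most `3 / 4`, independently (`card_isFake_le`).
The sum over all sets is `O(2^b (3/4)^{n - b})`, which is `O(1 / K)` for `K = O(2^{n/6})`.

Probabilities are counts of `K`-tuples of arbitrary points; since `2 K² ≤ 2^n`,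
restricting to tuples of distinct points at most doubles them (`one_sub_le_prob`).
-/

noncomputable section

namespace SparseMobius

open Prog

/-! ### Cost and correctness of programs -/

section

/-- The program `p`, run with oracle `f`, returns a value satisfying `Q` after at most `t` steps and
at most `q` samples. Bounds for a composite program are assembled by the rules below, so that where
they are given explicitly, they are unsimplified sums that mirror the program text. -/
def Ends {n : ℕ} {α : Type} (f : Cube n → ℝ) (p : Prog n α) (Q : α → Prop) (t q : ℕ) : Prop :=
  Q (p.output f) ∧ p.steps f ≤ t ∧ p.samples f ≤ q

namespace Ends

variable {n : ℕ} {α β : Type} {f : Cube n → ℝ}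

theorem mono {p : Prog n α} {Q R : α → Prop} {t t' q q' : ℕ} (h : Ends f p Q t q)
    (hR : ∀ a, Q a → R a) (ht : t ≤ t') (hq : q ≤ q') : Ends f p R t' q' :=
  ⟨hR _ h.1, h.2.1.trans ht, h.2.2.trans hq⟩

theorem ret {Q : α → Prop} {a : α} (h : Q a) : Ends f (Prog.ret a) Q 0 0 := ⟨h, le_rfl, le_rfl⟩

theorem step {p : Prog n α} {Q : α → Prop} {t q : ℕ} (h : Ends f p Q t q) :
    Ends f (Prog.step p) Q (t + 1) q := ⟨h.1, Nat.succ_le_succ h.2.1, h.2.2⟩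

theorem op {Q : α → Prop} {a : α} (h : Q a) : Ends f (Prog.op a) Q 1 0 := (ret h).step

theorem sample {Q : ℝ → Prop} {m : Cube n} (h : Q (f m)) : Ends f (Prog.sample m) Q 1 1 :=
  ⟨h, le_rfl, le_rfl⟩

theorem charge {Q : α → Prop} {a : α} (h : Q a) (t : ℕ) : Ends f (Prog.charge a t) Q t 0 := by
  induction t with
  | zero => exact ret h
  | succ t ih => exact ih.step

theorem readAt {s : ℕ} {T : Cube s → α} {x : Cube s} {Q : α → Prop} (h : Q (T x)) :
    Ends f (Prog.readAt T x) Q (s + 1) 0 := charge h _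

theorem writeAt {s : ℕ} {T : Cube s → α} {x : Cube s} {a : α} {Q : (Cube s → α) → Prop}
    (h : Q (Function.update T x a)) : Ends f (Prog.writeAt T x a) Q (s + 1) 0 := charge h _

theorem bind {p : Prog n α} {g : α → Prog n β} {Q : α → Prop} {R : β → Prop} {t₁ t₂ q₁ q₂ : ℕ}
    (hp : Ends f p Q t₁ q₁) (hg : ∀ a, Q a → Ends f (g a) R t₂ q₂) :
    Ends f (p >>= g) R (t₁ + t₂) (q₁ + q₂) := by
  change Ends f (p.bind g) R _ _
  induction p generalizing t₁ q₁ with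
  | ret a => exact (hg a hp.1).mono (fun _ h => h) (by omega) (by omega)
  | step p ih =>
    obtain ⟨t, rfl⟩ : ∃ t, t₁ = t + 1 :=
      ⟨t₁ - 1, by have := hp.2.1; simp only [Prog.steps] at this; omega⟩
    have := (ih (t₁ := t) (q₁ := q₁) ⟨hp.1, Nat.le_of_succ_le_succ hp.2.1, hp.2.2⟩).step
    exact this.mono (fun _ h => h) (by omega) le_rfl
  | query m k ih =>
    obtain ⟨hQ, ht, hq⟩ := hp
    simp only [Prog.steps, Prog.samples] at ht hq
    have := ih (f m) (t₁ := t₁ - 1) (q₁ := q₁ - 1) ⟨hQ, by omega, by omega⟩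
    refine ⟨this.1, ?_, ?_⟩
    · have := this.2.1
      simp only [Prog.bind, Prog.steps]
      omega
    · have := this.2.2
      simp only [Prog.bind, Prog.samples]
      omega

theorem tabulate {m : ℕ} {g : Fin m → Prog n α} {Q : Fin m → α → Prop} {t q : ℕ}
    (h : ∀ i, Ends f (g i) (Q i) t q) :
    Ends f (Prog.tabulate m g) (fun a => ∀ i, Q i (a i)) (m * (t + 1)) (m * q) := by
  induction m with
  | zero => exact (ret fun i => i.elim0).mono (fun _ h => h) (by omega) (by omega)
  | succ m ih =>
    refine mono (bind (h 0) fun a ha => bind (ih fun i => h i.succ) fun b hb =>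
      op (Q := fun a : Fin (m + 1) → α => ∀ i, Q i (a i)) ?_)
      (fun _ h => h) ?_ ?_
    · intro i
      refine Fin.cases ?_ (fun i => ?_) i
      · simpa using ha
      · simpa using hb i
    · rw [Nat.succ_mul]; omega
    · rw [Nat.succ_mul]; omega

/-- The form of `Ends.tabulate` in which the entries are known exactly. -/
theorem tabulate_eq {m : ℕ} {g : Fin m → Prog n α} {v : Fin m → α} {t q : ℕ}
    (h : ∀ i, Ends f (g i) (· = v i) t q) :
    Ends f (Prog.tabulate m g) (· = v) (m * (t + 1)) (m * q) :=
  (tabulate h).mono (fun _ h => funext h) le_rfl le_rfl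

/-- A loop over `Fin m` keeps an invariant indexed by the number of completed rounds. -/
theorem forFin {m : ℕ} {g : Fin m → β → Prog n β} {I : ℕ → β → Prop} {t q : ℕ} {x : β}
    (h : ∀ (i : Fin m) y, I i y → Ends f (g i y) (I (i + 1)) t q) (hx : I 0 x) :
    Ends f (Prog.forFin m g x) (I m) (m * (t + 1)) (m * q) := by
  induction m generalizing I x with
  | zero => exact (ret hx).mono (fun _ h => h) (by omega) (by omega)
  | succ m ih =>
    refine mono (bind (h 0 x hx).step fun y hy => ih (I := fun i => I (i + 1))
      (fun i z hz => ?_) hy) (fun _ h => h) ?_ ?_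
    · simpa using h i.succ z (by simpa using hz)
    · rw [Nat.succ_mul]; omega
    · rw [Nat.succ_mul]; omega

/-- A loop over a list keeps an invariant indexed by the part of the list that is still to come. -/
theorem forList {g : α → β → Prog n β} {I : List α → β → Prop} {t q : ℕ}
    (h : ∀ a l y, I (a :: l) y → Ends f (g a y) (I l) t q) (l : List α) {x : β} (hx : I l x) :
    Ends f (Prog.forList l g x) (I []) (l.length * (t + 1)) (l.length * q) := by
  induction l generalizing x with
  | nil => exact (ret hx).mono (fun _ h => h) (by omega) (by omega)
  | cons a l ih =>
    refine mono (bind (h a l x hx).step fun y hy => ih hy) (fun _ h => h) ?_ ?_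
    · rw [List.length_cons, Nat.succ_mul]; omega
    · rw [List.length_cons, Nat.succ_mul]; omega

theorem tabulateCube {s : ℕ} {g : Cube s → Prog n α} {v : Cube s → α} {t q : ℕ}
    (h : ∀ x, Ends f (g x) (· = v x) t q) :
    Ends f (Prog.tabulateCube s g) (· = v) (2 ^ s * (t + 2)) (2 ^ s * q) := by
  suffices H : Ends f (Prog.tabulateCube s g) (· = v) (2 ^ s * (t + 2) - 1) (2 ^ s * q) from
    H.mono (fun _ h => h) (by omega) le_rfl
  induction s with
  | zero =>
    refine mono (bind (h Fin.elim0) fun a ha => op (Q := (· = v)) ?_) (fun _ h => h)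
      (by omega) (by omega)
    funext x
    rw [ha, Subsingleton.elim x Fin.elim0]
  | succ s ih =>
    refine mono (bind (ih fun x => h (Fin.cons false x)) fun a ha =>
      bind (ih fun x => h (Fin.cons true x)) fun b hb => op (Q := (· = v)) ?_) (fun _ h => h) ?_ ?_
    · funext x
      subst ha hb
      unfold join
      rcases hx : x 0 with _ | _
      · rw [← hx]; simp only [Bool.false_eq_true, ↓reduceIte, hx]
        rw [← hx, Fin.cons_self_tail]
      · simp only [↓reduceIte]
        rw [← hx, Fin.cons_self_tail]
    · have : 0 < 2 ^ s * (t + 2) := by positivity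
      rw [pow_succ]; ring_nf at this ⊢; omega
    · rw [pow_succ]; ring_nf; omega

/-- A loop over the cube keeps an invariant indexed by the set of points already visited. -/
theorem forCube {s : ℕ} {g : Cube s → β → Prog n β} {I : Finset (Cube s) → β → Prop} {t q : ℕ}
    (h : ∀ A x y, x ∉ A → I A y → Ends f (g x y) (I (insert x A)) t q) {y : β} (hy : I ∅ y) :
    Ends f (Prog.forCube s g y) (I Finset.univ) (2 ^ s * (t + 2)) (2 ^ s * q) := by
  suffices H : Ends f (Prog.forCube s g y) (I Finset.univ) (2 ^ s * (t + 2) - 1) (2 ^ s * q) from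
    H.mono (fun _ h => h) (by omega) le_rfl
  induction s generalizing y with
  | zero =>
    refine mono (h ∅ Fin.elim0 y (by simp) hy).step (fun a ha => ?_) (by omega) (by omega)
    convert ha
    exact (Finset.eq_univ_iff_forall.2 fun x => by simp [Subsingleton.elim x Fin.elim0]).symm
  | succ s ih =>
    have hc : ∀ a : Bool, Function.Injective (fun x : Cube s => (Fin.cons a x : Cube (s + 1))) :=
      fun a => Fin.cons_right_injective (α := fun _ => Bool) a
    let E : Finset (Cube s) → Bool → Finset (Cube (s + 1)) := fun A a => A.map ⟨_, hc a⟩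
    refine mono (bind (ih (I := fun A => I (E A false)) (fun A x z hx hz => ?_)
      (by simpa [E] using hy)).step fun z hz =>
        ih (I := fun A => I (E Finset.univ false ∪ E A true)) (fun A x z hx hz => ?_)
          (by simpa [E] using hz)) (fun a ha => ?_) ?_ ?_
    · have := h (E A false) (Fin.cons false x) z (by simpa [E] using hx) hz
      simpa [E] using this
    · have := h (E Finset.univ false ∪ E A true) (Fin.cons true x) z
        (by simpa [E, Fin.cons_inj] using hx) hz
      simpa [E, Finset.union_insert] using this
    · convert ha
      symm
      rw [Finset.eq_univ_iff_forall]
      intro x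
      rw [← Fin.cons_self_tail x]
      rcases x 0 <;> simp [E, Fin.cons_inj]
    · have : 0 < 2 ^ s * (t + 2) := by positivity
      rw [pow_succ]; ring_nf at this ⊢; omega
    · rw [pow_succ]; ring_nf; omega

end Ends

end

/-! ### Subsampling and the Möbius transform -/

section

theorem not_true_le_false : ¬ true ≤ false := by decide

theorem sum_cube_succ {s : ℕ} (g : Cube (s + 1) → ℝ) :
    ∑ x, g x = ∑ x : Cube s, g (Fin.cons false x) + ∑ x : Cube s, g (Fin.cons true x) := by
  rw [← (Fin.consEquiv fun _ : Fin (s + 1) => Bool).sum_comp, Fintype.sum_prod_type]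
  simp [Fin.consEquiv, add_comm]

theorem mobius_cons_false {n : ℕ} (f : Cube (n + 1) → ℝ) (k : Cube n) :
    mobius f (Fin.cons false k) = mobius (fun x => f (Fin.cons false x)) k := by
  simp [mobius, sum_cube_succ, Fin.forall_fin_succ, Fin.card_filter_univ_succ, not_true_le_false]

theorem mobius_cons_true {n : ℕ} (f : Cube (n + 1) → ℝ) (k : Cube n) :
    mobius f (Fin.cons true k) =
      mobius (fun x => f (Fin.cons true x)) k - mobius (fun x => f (Fin.cons false x)) k := by
  simp only [mobius, sum_cube_succ, Fin.forall_fin_succ, Fin.card_filter_univ_succ]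
  rw [add_comm, sub_eq_add_neg, ← Finset.sum_neg_distrib]
  congr 1
  · simp
  · refine Finset.sum_congr rfl fun x _ => ?_
    simp [pow_succ, neg_ite]

/-- Möbius inversion on the cube. -/
theorem sum_mobius {n : ℕ} (f : Cube n → ℝ) (x : Cube n) :
    f x = ∑ k, if ∀ i, k i ≤ x i then mobius f k else 0 := by
  induction n with
  | zero =>
    simp [mobius]
    exact congrArg f (Subsingleton.elim _ _)
  | succ n ih =>
    rw [sum_cube_succ, ← Fin.cons_self_tail x]
    have h0 := ih (fun y => f (Fin.cons false y)) (Fin.tail x)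
    have h1 := ih (fun y => f (Fin.cons true y)) (Fin.tail x)
    simp only [Fin.forall_fin_succ, Fin.cons_zero, Fin.cons_succ, mobius_cons_false,
      mobius_cons_true]
    rcases x 0 with _ | _
    · simpa [not_true_le_false] using h0
    · simp only [Bool.false_le, true_and, le_refl]
      rw [← h0]
      simp only [← Finset.sum_filter, Finset.sum_sub_distrib] at h0 h1 ⊢
      linarith

/-- The divide-and-conquer transform inverts summation over lower sets. -/
theorem Ends.fastMobius {n s : ℕ} {f : Cube n → ℝ} {u g : Cube s → ℝ}
    (h : ∀ x, u x = ∑ k, if ∀ i, k i ≤ x i then g k else 0) :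
    Ends f (fastMobius s u) (· = g) (4 * (s + 1) * 2 ^ s) 0 := by
  induction s with
  | zero =>
    refine (op (Q := (· = g)) ?_).mono (fun _ h => h) (by norm_num) le_rfl
    funext x
    rw [h x]
    simp only [Subsingleton.elim x default, Finset.univ_unique, Finset.sum_singleton]
    simp only [IsEmpty.forall_iff, if_true]
    exact congrArg g (Subsingleton.elim _ _)
  | succ s ih =>
    have h0 : ∀ x : Cube s, u (Fin.cons false x) =
        ∑ k : Cube s, if ∀ i, k i ≤ x i then g (Fin.cons false k) else 0 := by
      intro x
      rw [h, sum_cube_succ]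
      simp [Fin.forall_fin_succ, not_true_le_false]
    have h1 : ∀ x : Cube s, u (Fin.cons true x) =
        ∑ k : Cube s, if ∀ i, k i ≤ x i then g (Fin.cons false k) + g (Fin.cons true k) else 0 := by
      intro x
      rw [h, sum_cube_succ, ← Finset.sum_add_distrib]
      refine Finset.sum_congr rfl fun k _ => ?_
      simp only [Fin.forall_fin_succ, Fin.cons_zero, Fin.cons_succ, Bool.false_le, true_and,
        le_refl]
      split_ifs <;> simp
    refine mono (bind (ih h0) fun l hl => bind (ih h1) fun r hr =>
      bind (Ends.tabulateCube (v := fun x => g (Fin.cons true x)) (t := 1) (q := 0) fun x =>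
        op ?_) fun d hd => op (Q := (· = g)) ?_) (fun _ h => h) ?_ (by omega)
    · subst hl hr
      ring
    · subst hl hd
      funext x
      rw [← Fin.cons_self_tail x]
      unfold join
      rcases x 0 with _ | _ <;> simp
    · have : 1 ≤ 2 ^ s := Nat.one_le_two_pow
      rw [pow_succ]
      nlinarith

theorem Ends.mulVec {n r s : ℕ} {f : Cube n → ℝ} (A : BMatrix r s) (x : Cube s) :
    Ends f (mulVec A x) (· = fun i => decide (∃ j, A i j = true ∧ x j = true))
      (r * (s * 2 + 1)) 0 := by
  refine Ends.mono (Ends.tabulate_eq (q := 0) fun i => ?_) (fun _ h => h) le_rfl (by omega)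
  refine (Ends.forFin (t := 1) (q := 0) (I := fun m (a : Bool) =>
    a = decide (∃ j : Fin s, (j : ℕ) < m ∧ A i j = true ∧ x j = true))
    (fun j a ha => Ends.op ?_) (by simp)).mono ?_ le_rfl (by omega)
  · rw [ha, Bool.eq_iff_iff]
    simp only [Bool.or_eq_true, decide_eq_true_eq, Bool.and_eq_true]
    constructor
    · rintro (⟨j', h1, h2⟩ | h)
      · exact ⟨j', by omega, h2⟩
      · exact ⟨j, by omega, h⟩
    · rintro ⟨j', h1, h2⟩
      by_cases hj : j' = j
      · exact .inr (hj ▸ h2)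
      · exact .inl ⟨j', by have := Fin.val_ne_of_ne hj; omega, h2⟩
  · rintro a rfl
    simp

/-- The Boolean product of a coordinate matrix with `k` selects coordinates of `k`. -/
theorem Ends.mulVec_coordMatrix {n b : ℕ} {f : Cube n → ℝ} (I : Fin b → Fin n) (k : Cube n) :
    Ends f (SparseMobius.mulVec (coordMatrix I) k) (· = k ∘ I) (b * (n * 2 + 1)) 0 := by
  refine (Ends.mulVec _ _).mono ?_ le_rfl le_rfl
  rintro _ rfl
  funext i
  simp [coordMatrix]

theorem Ends.mulVec_idMatrix {n : ℕ} {f : Cube n → ℝ} (k : Cube n) :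
    Ends f (SparseMobius.mulVec (idMatrix n) k) (· = k) (n * (n * 2 + 1)) 0 := by
  refine (Ends.mulVec _ _).mono ?_ le_rfl le_rfl
  rintro _ rfl
  funext i
  simp [idMatrix]

/-- The bit `d_p^T k`, for the delays `d_0 = 0` and `d_p = e_p`. -/
def delayBit {n : ℕ} (k : Cube n) : Fin (n + 1) → Bool := Fin.cons false k

@[simp] theorem delayBit_zero {n : ℕ} (k : Cube n) : delayBit k 0 = false := rfl

@[simp] theorem delayBit_succ {n : ℕ} (k : Cube n) (p : Fin n) : delayBit k p.succ = k p := rfl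

/-- The `p`-th entry of the bin `j` of the group given by `I`, for the Möbius coefficients `F`. -/
def contents {n b : ℕ} (I : Fin b → Fin n) (F : Cube n → ℝ) (p : Fin (n + 1)) (j : Cube b) : ℝ :=
  ∑ k, if k ∘ I = j ∧ delayBit k p = false then F k else 0

/-- Subsampling aliases the Möbius coefficients: all `k` with the same image share a bin. -/
theorem Ends.subsample {n b : ℕ} (I : Fin b → Fin n) (f : Cube n → ℝ) (hb : b ≤ n) :
    Ends f (subsample (coordMatrix I) (idMatrix n)) (· = contents I (mobius f))
      (20 * (n + 1) ^ 2 * 2 ^ b) ((n + 1) * 2 ^ b) := by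
  have hbase : ∀ l : Cube b, Ends f (do
      let nl ← Prog.tabulate b fun i => Prog.op (!(l i))
      SparseMobius.mulVec (fun i j => coordMatrix I j i) nl)
      (· = fun i => decide (∃ j, I j = i ∧ l j = false)) (b * 2 + n * (b * 2 + 1)) 0 := by
    intro l
    refine (Ends.bind (Ends.tabulate_eq (v := fun i => !(l i)) (t := 1) (q := 0) fun i =>
      Ends.op rfl) fun a ha => by
        subst ha; exact Ends.mulVec _ _).mono (t := b * (1 + 1) + n * (b * 2 + 1)) (q := b * 0 + 0) ?_
        (by omega) (by omega)
    rintro _ rfl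
    simp [coordMatrix]
  refine (Ends.bind (Ends.tabulateCube hbase) fun base hB => ?_).mono
    (t := 2 ^ b * (b * 2 + n * (b * 2 + 1) + 2) +
      (n + 1) * (2 ^ b * (n * 2 + 1 + 2) + 4 * (b + 1) * 2 ^ b + 1))
    (q := 2 ^ b * 0 + (n + 1) * (2 ^ b * 1 + 0)) (fun _ h => h) ?_ (by simp)
  · refine Ends.tabulate_eq fun p => ?_
    refine Ends.bind (Ends.tabulateCube
      (v := fun l => ∑ j, if ∀ i, j i ≤ l i then contents I (mobius f) p j else 0) fun l =>
        (Ends.bind (Ends.tabulate_eq (v := fun i => !(base l i ||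
          (Fin.cons (fun _ => false) (idMatrix n) : BMatrix (n + 1) n) p i)) (t := 1) (q := 0)
            fun i => Ends.op rfl) fun m hm =>
          Ends.sample (Q := (· = _)) ?_).mono (t := n * (1 + 1) + 1) (q := n * 0 + 1)
              (t' := n * 2 + 1) (q' := 1)
              (fun _ h => h) (by omega) (by omega)) fun u hu =>
            by subst hu; exact Ends.fastMobius fun x => rfl
    have hk : ∀ k : Cube n, (∀ i, k i ≤ m i) ↔ (∀ i, (k ∘ I) i ≤ l i) ∧ delayBit k p = false := by
      intro k
      subst hm hB
      have h1 : ∀ i, k i ≤ (!(decide (∃ j, I j = i ∧ l j = false) ||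
          (Fin.cons (fun _ => false) (idMatrix n) : BMatrix (n + 1) n) p i)) ↔
          (k i = true → (∀ j, I j = i → l j = true) ∧
            (Fin.cons (fun _ => false) (idMatrix n) : BMatrix (n + 1) n) p i = false) := by
        intro i
        rw [Bool.le_iff_imp]
        simp
      simp only [h1]
      refine Fin.cases ?_ (fun p => ?_) p
      · simp only [Fin.cons_zero, and_true, delayBit_zero, Function.comp_apply, Bool.le_iff_imp]
        exact ⟨fun h j hj => h _ hj j rfl, fun h i hi j hj => h j (hj ▸ hi)⟩
      · simp only [Fin.cons_succ, delayBit_succ, Function.comp_apply, Bool.le_iff_imp, idMatrix,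
          decide_eq_false_iff_not]
        refine ⟨fun h => ⟨fun j hj => (h _ hj).1 j rfl, ?_⟩, fun h i hi =>
          ⟨fun j hj => h.1 j (hj ▸ hi), fun hp => ?_⟩⟩
        · by_contra hp
          exact (h p (by simpa using hp)).2 rfl
        · rw [← hp, h.2] at hi
          exact absurd hi (by decide)
    rw [sum_mobius f m]
    simp only [contents, hk]
    have hpush : ∀ j : Cube b, (if ∀ i, j i ≤ l i then
        ∑ k, if k ∘ I = j ∧ delayBit k p = false then mobius f k else 0 else 0) =
        ∑ k, if (∀ i, j i ≤ l i) ∧ k ∘ I = j ∧ delayBit k p = false then mobius f k else 0 := by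
      intro j
      split_ifs with h <;> simp [h]
    simp only [hpush]
    rw [Finset.sum_comm]
    refine Finset.sum_congr rfl fun k _ => ?_
    rw [Finset.sum_eq_single (k ∘ I) (fun j _ hj => if_neg fun h => hj h.2.1.symm) (by simp)]
    simp
  · have h1 : 1 ≤ 2 ^ b := Nat.one_le_two_pow
    generalize 2 ^ b = M at *
    calc M * (b * 2 + n * (b * 2 + 1) + 2) +
          (n + 1) * (M * (n * 2 + 1 + 2) + 4 * (b + 1) * M + 1)
        ≤ M * (b * 2 + n * (b * 2 + 1) + 2) +
          (n + 1) * (M * (n * 2 + 1 + 2) + 4 * (b + 1) * M + M) := by gcongr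
      _ = (b * 2 + n * (b * 2 + 1) + 2 + (n + 1) * (n * 2 + 4 + 4 * (b + 1))) * M := by ring
      _ ≤ (n * 2 + n * (n * 2 + 1) + 2 + (n + 1) * (n * 2 + 4 + 4 * (n + 1))) * M := by gcongr
      _ ≤ 20 * (n + 1) ^ 2 * M := by gcongr; nlinarith

end

/-! ### Type estimation and peeling of one bin -/

section

theorem Ends.detect {n : ℕ} (f : Cube n → ℝ) (u : Fin (n + 1) → ℝ) :
    Ends f (detect (fun y => Prog.ret y) u) (fun t =>
      ((u 0 ≠ 0 ∧ ∀ p : Fin n, u p.succ = 0 ∨ u p.succ = u 0) →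
        t = BinType.singleton (fun p => decide (u p.succ = 0)) (u 0)) ∧
      (¬(u 0 ≠ 0 ∧ ∀ p : Fin n, u p.succ = 0 ∨ u p.succ = u 0) →
        ∀ k v, t ≠ BinType.singleton k v)) (20 * (n + 1)) 0 := by
  have hz : Ends f (Prog.forFin (n + 1) (fun p acc => Prog.op (acc && decide (u p = 0))) true)
      (· = decide (∀ p, u p = 0)) ((n + 1) * (1 + 1)) ((n + 1) * 0) := by
    refine (Ends.forFin (I := fun m a => a = decide (∀ p : Fin (n + 1), (p : ℕ) < m → u p = 0))
      (fun p a ha => Ends.op ?_) (by simp)).mono (fun a ha => by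
        rw [ha]; exact decide_eq_decide.2 ⟨fun h p => h p p.2, fun h p _ => h p⟩)
      le_rfl le_rfl
    rw [ha, Bool.eq_iff_iff]
    simp only [Bool.and_eq_true, decide_eq_true_eq]
    refine ⟨fun h q hq => ?_, fun h => ⟨fun q hq => h q (by omega), h p (by omega)⟩⟩
    by_cases hqp : q = p
    · exact hqp ▸ h.2
    · exact h.1 q (by have := Fin.val_ne_of_ne hqp; omega)
  refine Ends.mono (t := (n + 1) * (1 + 1) + (1 + (n * (1 + 1 + 1) + (n * (1 + 1) +
    (n * (1 + 1) + (0 + 1)))))) (q := (n + 1) * 0 + (0 + (n * 0 + (n * 0 + (n * 0 + (0 + 0))))))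
    (Ends.bind hz fun z hz => ?_) (fun _ h => h) (by ring_nf; omega) (by omega)
  by_cases h0 : ∀ p, u p = 0
  · rw [if_pos (by simp [hz, h0])]
    exact (Ends.op ⟨fun h => absurd (h0 0) h.1, fun _ k v => by simp⟩).mono (fun _ h => h)
      (by omega) (by omega)
  rw [if_neg (by simp [hz, h0])]
  refine Ends.bind (Ends.op (Q := (· = decide (u 0 = 0))) rfl) fun z₀ hz₀ => ?_
  by_cases h1 : u 0 = 0
  · rw [if_pos (by simp [hz₀, h1])]
    exact (Ends.op ⟨fun h => absurd h1 h.1, fun _ k v => by simp⟩).mono (fun _ h => h)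
      (by omega) (by omega)
  rw [if_neg (by simp [hz₀, h1])]
  refine Ends.bind (Ends.tabulate_eq (v := fun p => 1 - u p.succ / u 0) (q := 0) fun p =>
    Ends.bind (Ends.op (Q := (· = u p.succ / u 0)) rfl) fun q hq => Ends.op (by rw [hq]))
    fun y hy => ?_
  have hone : ∀ p, y p = 1 ↔ u p.succ = 0 := by
    intro p
    rw [hy]
    simp [h1]
  have hzero : ∀ p, y p = 0 ↔ u p.succ = u 0 := by
    intro p
    rw [hy]
    simp only [sub_eq_zero]
    rw [eq_comm, div_eq_one_iff_eq h1]
  have hok : Ends f (Prog.forFin n (fun p acc =>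
      Prog.op (acc && (decide (y p = 0) || decide (y p = 1)))) true)
      (· = decide (∀ p : Fin n, u p.succ = 0 ∨ u p.succ = u 0)) (n * (1 + 1)) (n * 0) := by
    refine (Ends.forFin (I := fun m a =>
      a = decide (∀ p : Fin n, (p : ℕ) < m → u p.succ = 0 ∨ u p.succ = u 0))
      (fun p a ha => Ends.op ?_) (by simp)).mono (by rintro _ rfl; simp) le_rfl le_rfl
    rw [ha, Bool.eq_iff_iff]
    simp only [Bool.and_eq_true, Bool.or_eq_true, decide_eq_true_eq, hone, hzero]
    refine ⟨fun h q hq => ?_, fun h => ⟨fun q hq => h q (by omega), (h p (by omega)).symm⟩⟩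
    by_cases hqp : q = p
    · exact hqp ▸ h.2.symm
    · exact h.1 q (by have := Fin.val_ne_of_ne hqp; omega)
  refine Ends.bind hok fun ok hok => ?_
  by_cases h2 : ∀ p : Fin n, u p.succ = 0 ∨ u p.succ = u 0
  · rw [if_pos (by simp [hok, h2])]
    refine Ends.bind (Ends.tabulate_eq (v := fun p => decide (u p.succ = 0)) (q := 0) (t := 1)
      fun p => Ends.op (by simp [hone])) fun bits hbits =>
        Ends.bind (Ends.ret (Q := (· = bits)) rfl) fun k hk => Ends.op ⟨fun _ => ?_, fun h => ?_⟩
    · rw [hk, hbits]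
    · exact absurd ⟨h1, h2⟩ h
  · rw [if_neg (by simp [hok, h2])]
    exact (Ends.op ⟨fun h => absurd h.2 h2, fun _ k v => by simp⟩).mono (fun _ h => h)
      (by omega) (by omega)

variable {n b : ℕ}

/-- `k` is the only point with a nonzero coefficient of `R` in the bin `x`. -/
def Isolated (I : Fin 3 → Fin b → Fin n) (R : Cube n → ℝ) (x : Bin 3 b) (k : Cube n) : Prop :=
  R k ≠ 0 ∧ k ∘ I x.1 = x.2 ∧ ∀ l, R l ≠ 0 → l ∘ I x.1 = x.2 → l = k

/-- No set of at least two points with nonzero coefficients that share a bin passes the singleton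
test `y ∈ {0,1}^n` of the type estimation, even if the test is written without division, as
`U_p ∈ {0, U_0}`, so that `U_0 = 0` is allowed. -/
def Unambiguous (I : Fin 3 → Fin b → Fin n) (F : Cube n → ℝ) : Prop :=
  ∀ c, ∀ A : Finset (Cube n), 2 ≤ A.card → (∀ k ∈ A, F k ≠ 0) →
    (∀ k ∈ A, ∀ l ∈ A, k ∘ I c = l ∘ I c) →
    ∃ p, ∑ k ∈ A with k p = false, F k ≠ 0 ∧ ∑ k ∈ A with k p = false, F k ≠ ∑ k ∈ A, F k

/-- Every nonempty set of points with nonzero coefficients has a member that is alone in one of its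
bins: the 3-partite hypergraph whose edges are these points and whose vertices are the bins has an
empty 2-core. -/
def Peelable (I : Fin 3 → Fin b → Fin n) (F : Cube n → ℝ) : Prop :=
  ∀ A : Finset (Cube n), A.Nonempty → (∀ k ∈ A, F k ≠ 0) →
    ∃ c, ∃ k ∈ A, ∀ l ∈ A, l ∘ I c = k ∘ I c → l = k

/-- The coefficients of `F` whose locations are not yet known. -/
def residual (F : Cube n → ℝ) (known : Cube n → Bool) (k : Cube n) : ℝ :=
  if known k then 0 else F k

theorem residual_ne_zero {F : Cube n → ℝ} {known : Cube n → Bool} {k : Cube n} :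
    residual F known k ≠ 0 ↔ known k = false ∧ F k ≠ 0 := by
  unfold residual
  split_ifs with h <;> simp [h]

theorem contents_eq_of_isolated {I : Fin 3 → Fin b → Fin n} {R : Cube n → ℝ} {x : Bin 3 b}
    {k : Cube n} (h : Isolated I R x k) (p : Fin (n + 1)) :
    contents (I x.1) R p x.2 = if delayBit k p = false then R k else 0 := by
  unfold contents
  rw [Finset.sum_eq_single k]
  · simp [h.2.1]
  · intro l _ hl
    by_cases hR : R l = 0
    · simp [hR]
    · exact if_neg fun hx => hl (h.2.2 l hR hx.1)
  · simp

/-- For unambiguous coefficients, a residual bin passes the singleton test exactly if it holds a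
single point. -/
theorem exists_isolated_of_ratios {I : Fin 3 → Fin b → Fin n} {F : Cube n → ℝ}
    (hF : Unambiguous I F) {known : Cube n → Bool} {x : Bin 3 b}
    (h0 : contents (I x.1) (residual F known) 0 x.2 ≠ 0)
    (hp : ∀ p : Fin n, contents (I x.1) (residual F known) p.succ x.2 = 0 ∨
      contents (I x.1) (residual F known) p.succ x.2 =
        contents (I x.1) (residual F known) 0 x.2) :
    ∃ k, Isolated I (residual F known) x k := by
  classical
  set A : Finset (Cube n) :=
    Finset.univ.filter fun k => residual F known k ≠ 0 ∧ k ∘ I x.1 = x.2 with hA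
  have hAF : ∀ k ∈ A, residual F known k = F k := by
    intro k hk
    have := residual_ne_zero.1 (Finset.mem_filter.1 hk).2.1
    simp [residual, this.1]
  have hsum : ∀ p, contents (I x.1) (residual F known) p x.2 =
      ∑ k ∈ A with delayBit k p = false, F k := by
    intro p
    rw [Finset.sum_congr rfl fun k hk => (hAF k (Finset.mem_filter.1 hk).1).symm, hA,
      Finset.filter_filter, contents, Finset.sum_filter]
    refine Finset.sum_congr rfl fun k _ => ?_
    by_cases hR : residual F known k = 0 <;> simp [hR]
  have hsum0 : contents (I x.1) (residual F known) 0 x.2 = ∑ k ∈ A, F k := by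
    rw [hsum]; simp
  have hcard : A.card < 2 := by
    by_contra hc
    obtain ⟨p, hp0, hp1⟩ := hF x.1 A (by omega)
      (fun k hk => (residual_ne_zero.1 (Finset.mem_filter.1 hk).2.1).2)
      (fun k hk l hl => (Finset.mem_filter.1 hk).2.2.trans (Finset.mem_filter.1 hl).2.2.symm)
    have := hp p
    rw [hsum0, hsum] at this
    exact this.elim hp0 hp1
  have hne : A.Nonempty := by
    rw [Finset.nonempty_iff_ne_empty]
    intro h
    rw [hsum0, h] at h0
    exact h0 rfl
  obtain ⟨k, hk⟩ := Finset.card_eq_one.1 (show A.card = 1 by have := hne.card_pos; omega)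
  have hmem : ∀ l, residual F known l ≠ 0 → l ∘ I x.1 = x.2 → l = k := by
    intro l h1 h2
    have : l ∈ A := Finset.mem_filter.2 ⟨Finset.mem_univ _, h1, h2⟩
    rwa [hk, Finset.mem_singleton] at this
  have hkA : k ∈ A := by rw [hk]; simp
  exact ⟨k, (Finset.mem_filter.1 hkA).2.1, (Finset.mem_filter.1 hkA).2.2, hmem⟩

/-- The decoder for `D = 1`. -/
abbrev idDecoder (n : ℕ) : Fin 3 → Cube n → Prog n (Cube n) := fun _ y => ret y

theorem Ends.scan {I : Fin 3 → Fin b → Fin n} {F : Cube n → ℝ} (hF : Unambiguous I F)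
    (f : Cube n → ℝ) (hb : b ≤ n) (known : Cube n → Bool) (x : Bin 3 b)
    (S : List (Entry 3 b n)) :
    Ends f (scan (idDecoder n) (fun c => contents (I c) (residual F known)) x S) (fun S' =>
      (∃ k, Isolated I (residual F known) x k ∧ S' = (x, k, F k) :: S) ∨
      ((¬ ∃ k, Isolated I (residual F known) x k) ∧ S' = S)) (40 * (n + 1) ^ 2) 0 := by
  refine Ends.mono (t := (n + 1) * (b + 1 + 1) + (20 * (n + 1) + 1)) (q := (n + 1) * 0 + (0 + 0))
    (Ends.bind (Ends.tabulate_eq fun p => Ends.readAt rfl) fun u hu =>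
    Ends.bind (Ends.detect f u) fun t ht => ?_) (fun _ h => h) (by nlinarith) (by omega)
  obtain ⟨h1, h2⟩ := ht
  by_cases hk : ∃ k, Isolated I (residual F known) x k
  · obtain ⟨k, hk⟩ := hk
    have hval : ∀ p, u p = if delayBit k p = false then F k else 0 := by
      intro p
      rw [hu]
      simp only [contents_eq_of_isolated hk]
      have := residual_ne_zero.1 hk.1
      simp [residual, this.1]
    have hFk := (residual_ne_zero.1 hk.1).2
    have hu0 : u 0 = F k := by simp [hval]
    have hsing := h1 ⟨by rwa [hu0], fun p => by
      rw [hu0, hval, delayBit_succ]; rcases k p <;> simp⟩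
    rw [hsing]
    refine Ends.op (.inl ⟨k, hk, ?_⟩)
    rw [hu0]
    congr 3
    funext p
    rw [hval, delayBit_succ]
    rcases k p <;> simp [hFk]
  · have hno := h2 fun h => hk (exists_isolated_of_ratios hF (x := x) (known := known)
      (by simpa [hu] using h.1) (by simpa [hu] using h.2))
    cases t with
    | zeroton => exact Ends.op (.inr ⟨hk, rfl⟩)
    | multiton => exact Ends.op (.inr ⟨hk, rfl⟩)
    | singleton k v => exact absurd rfl (hno k v)

/-- Setting the coefficient at `k` to zero changes the entries of one bin of each group. -/
theorem update_contents (I : Fin b → Fin n) (R : Cube n → ℝ) (k : Cube n) (p : Fin (n + 1)) :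
    Function.update (contents I R p) (k ∘ I)
      (contents I R p (k ∘ I) - R k * (1 - if delayBit k p then 1 else 0)) =
      contents I (Function.update R k 0) p := by
  classical
  have key : ∀ j, contents I R p j = contents I (Function.update R k 0) p j +
      if k ∘ I = j ∧ delayBit k p = false then R k else 0 := by
    intro j
    unfold contents
    rw [← Finset.add_sum_erase _ _ (Finset.mem_univ k),
      ← Finset.add_sum_erase (a := k) (f := fun k_1 =>
        if k_1 ∘ I = j ∧ delayBit k_1 p = false then Function.update R k 0 k_1 else 0) _
        (Finset.mem_univ k)]
    rw [Finset.sum_congr rfl fun l hl => by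
      rw [← Function.update_of_ne (Finset.ne_of_mem_erase hl) 0 R]]
    simp [add_comm]
  funext j
  by_cases hj : j = k ∘ I
  · subst hj
    rw [Function.update_self, key]
    rcases delayBit k p <;> simp
  · rw [Function.update_of_ne hj, key, if_neg fun h => hj h.1.symm, add_zero]

theorem Ends.subtract (I : Fin 3 → Fin b → Fin n) (f : Cube n → ℝ) (hb : b ≤ n) (R : Cube n → ℝ)
    (k : Cube n) (T : List (Bin 3 b)) :
    Ends f (subtract (fun c => coordMatrix (I c)) (fun _ => idMatrix n) k (R k)
      (fun c => contents (I c) R) T) (fun UT =>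
        UT.1 = (fun c => contents (I c) (Function.update R k 0)) ∧
        ∃ L : List (Bin 3 b), UT.2 = L ++ T ∧ L.length = 3 ∧ ∀ c, (c, k ∘ I c) ∈ L)
      (36 * (n + 1) ^ 2) 0 := by
  refine Ends.mono (t := 3 * (b * (n * 2 + 1) + (n * (n * 2 + 1) +
      ((n + 1) * (b + 1 + (1 + (1 + (b + 1 + 1))) + 1) + 1)) + 1))
    (q := 3 * (0 + (0 + ((n + 1) * (0 + (0 + (0 + (0 + 0)))) + 0))))
    (Ends.forFin (I := fun i (UT : Bins 3 b n × List (Bin 3 b)) =>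
      (∀ c : Fin 3, UT.1 c =
        if (c : ℕ) < i then contents (I c) (Function.update R k 0) else contents (I c) R) ∧
      ∃ L : List (Bin 3 b), UT.2 = L ++ T ∧ L.length = i ∧ ∀ c : Fin 3, (c : ℕ) < i →
        (c, k ∘ I c) ∈ L) (fun c UT h => Ends.bind (Ends.mulVec_coordMatrix _ k) fun j hj =>
        Ends.bind (Ends.mulVec_idMatrix k) fun e he => Ends.bind (Ends.forFin
        (I := fun i (Uc : Fin (n + 1) → Cube b → ℝ) => ∀ p : Fin (n + 1), Uc p = if (p : ℕ) < i then
          contents (I c) (Function.update R k 0) p else contents (I c) R p)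
          (fun p Uc hU => Ends.bind (Ends.readAt (Q := (· = Uc p j)) rfl) fun a ha =>
            Ends.bind (Ends.op (Q := (· = R k * (1 - if delayBit k p then 1 else 0))) ?_)
              fun w hw => Ends.bind (Ends.op (Q := (· = a - w)) rfl) fun r hr =>
              Ends.bind (Ends.writeAt (Q := (· = Function.update (Uc p) j r)) rfl) fun t ht =>
              Ends.op ?_) ?_) fun Uc hUc => Ends.op ?_) ?_) ?_ ?_ ?_
  · rw [he]; rfl
  · subst ha hw hr ht hj
    intro p'
    by_cases hp : p' = p
    · subst hp
      have := hU p'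
      rw [if_neg (lt_irrefl _)] at this
      rw [Function.update_self, this, update_contents, if_pos (Nat.lt_succ_self _)]
    · rw [Function.update_of_ne hp, hU p']
      have := Fin.val_ne_of_ne hp
      congr 1
      simp only [eq_iff_iff]
      omega
  · intro p
    rw [h.1 c]
    simp
  · refine ⟨?_, ?_⟩
    on_goal 1 =>
      intro c'
      change Function.update UT.1 c Uc c' = _
    by_cases hc : c' = c
    · subst hc
      rw [Function.update_self, if_pos (Nat.lt_succ_self _)]
      funext p
      rw [hUc p, if_pos p.2]
    · rw [Function.update_of_ne hc, h.1 c']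
      have := Fin.val_ne_of_ne hc
      congr 1
      simp only [eq_iff_iff]
      omega
    obtain ⟨L, hL, hlen, hmem⟩ := h.2
    refine ⟨(c, j) :: L, by simp [hL], by simp [hlen], fun c' hc' => ?_⟩
    by_cases hc : c' = c
    · subst hc; simp [hj]
    · have := Fin.val_ne_of_ne hc
      exact List.mem_cons_of_mem _ (hmem c' (by omega))
  · exact ⟨fun c => by simp, [], by simp⟩
  · rintro UT ⟨h1, L, h2, h3, h4⟩
    exact ⟨funext fun c => by rw [h1 c, if_pos c.2], L, h2, h3, fun c => h4 c c.2⟩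
  · nlinarith
  · omega

end

/-! ### The main loop -/

section

variable {n b : ℕ}

/-- The variables of the main loop are those of a run on `F`: the estimate is `F` at the known
locations, and the bins hold the coefficients at the others. -/
structure Valid (I : Fin 3 → Fin b → Fin n) (F : Cube n → ℝ) (s : State 3 b n n) : Prop where
  bins : s.bins = fun c => contents (I c) (residual F s.known)
  estimate : s.estimate = fun k => if s.known k then F k else 0
  known : ∀ k, s.known k = true → F k ≠ 0

/-- The number of nonzero coefficients whose locations are not yet known. -/
def unknownCount (F : Cube n → ℝ) (known : Cube n → Bool) : ℕ :=
  (Finset.univ.filter fun k => residual F known k ≠ 0).card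

/-- Every entry is a singleton bin of the residual, with its correct location and value. -/
def Entries (I : Fin 3 → Fin b → Fin n) (F : Cube n → ℝ) (known : Cube n → Bool)
    (S : List (Entry 3 b n)) : Prop :=
  ∀ x ∈ S, Isolated I (residual F known) x.1 x.2.1 ∧ x.2.2 = F x.2.1

/-- Every singleton bin of the residual has an entry. -/
def Complete (I : Fin 3 → Fin b → Fin n) (F : Cube n → ℝ) (known : Cube n → Bool)
    (S : List (Entry 3 b n)) : Prop :=
  ∀ y k, Isolated I (residual F known) y k → ∃ x ∈ S, x.1 = y

theorem residual_update (F : Cube n → ℝ) (known : Cube n → Bool) (k : Cube n) :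
    residual F (Function.update known k true) = Function.update (residual F known) k 0 := by
  funext l
  by_cases hl : l = k
  · subst hl; simp [residual]
  · simp [residual, hl]

theorem unknownCount_update {F : Cube n → ℝ} {known : Cube n → Bool} {k : Cube n}
    (hF : F k ≠ 0) (hk : known k = false) :
    unknownCount F (Function.update known k true) + 1 = unknownCount F known := by
  classical
  unfold unknownCount
  have : (Finset.univ.filter fun l => residual F (Function.update known k true) l ≠ 0) =
      (Finset.univ.filter fun l => residual F known l ≠ 0).erase k := by
    ext l
    rw [residual_update]
    by_cases hl : l = k
    · subst hl; simp
    · simp [hl]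
  rw [this]
  exact Finset.card_erase_add_one (by simpa [residual_ne_zero] using ⟨hk, hF⟩)

theorem Ends.process_known {I : Fin 3 → Fin b → Fin n} (f : Cube n → ℝ) (x : Entry 3 b n)
    (s : State 3 b n n) (T : List (Bin 3 b)) (hk : s.known x.2.1 = true) :
    Ends f (process (fun c => coordMatrix (I c)) (fun _ => idMatrix n) x (s, T))
      (· = (s, x.1 :: T)) (40 * (n + 1) ^ 2) 0 := by
  refine Ends.mono (t := n + 1 + 1) (q := 0 + 0)
    (Ends.bind (Ends.readAt (Q := (· = true)) hk) fun old hold => ?_)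
    (fun _ h => h) (by nlinarith) le_rfl
  subst hold
  exact Ends.op rfl

theorem Ends.process_unknown {I : Fin 3 → Fin b → Fin n} {F : Cube n → ℝ} (f : Cube n → ℝ)
    (hb : b ≤ n) (x : Entry 3 b n) (s : State 3 b n n) (T : List (Bin 3 b)) (hs : Valid I F s)
    (hk : s.known x.2.1 = false) (hx : x.2.2 = F x.2.1) (hF : F x.2.1 ≠ 0) :
    Ends f (process (fun c => coordMatrix (I c)) (fun _ => idMatrix n) x (s, T))
      (fun sT => Valid I F sT.1 ∧ sT.1.known = Function.update s.known x.2.1 true ∧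
        ∃ L, sT.2 = L ++ x.1 :: T ∧ L.length = 3 ∧ ∀ c, (c, x.2.1 ∘ I c) ∈ L)
      (40 * (n + 1) ^ 2) 0 := by
  have hres : residual F s.known x.2.1 = x.2.2 := by simp [residual, hk, hx]
  refine Ends.mono (t := n + 1 + (n + 1 + (n + 1 + (36 * (n + 1) ^ 2 + 1))))
    (q := 0 + (0 + (0 + (0 + 0))))
    (Ends.bind (Ends.readAt (Q := (· = false)) hk) fun old hold => ?_)
    (fun _ h => h) (by nlinarith) le_rfl
  subst hold
  rw [if_neg (by decide)]
  refine Ends.bind (Ends.writeAt (Q := (· = Function.update s.estimate x.2.1 x.2.2)) rfl)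
    fun est hest => Ends.bind
      (Ends.writeAt (Q := (· = Function.update s.known x.2.1 true)) rfl) fun known hknown =>
        Ends.bind (hs.bins ▸ hres ▸ Ends.subtract I f hb (residual F s.known) x.2.1 (x.1 :: T))
          fun UT hUT => Ends.op ⟨⟨?_, ?_, ?_⟩, hknown, hUT.2⟩
  · rw [hknown, residual_update]
    exact hUT.1
  · simp only [hknown, hest]
    funext l
    by_cases hl : l = x.2.1
    · subst hl; simp [hx]
    · simp [Function.update_of_ne hl, hs.estimate]
  · intro l hl
    simp only [hknown] at hl
    by_cases h : l = x.2.1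
    · exact h ▸ hF
    · rw [Function.update_of_ne h] at hl
      exact hs.known l hl

/-- One pass over the current singletons `S`. The last two bounds say that the list of touched bins
holds one bin for each entry of `S`, and up to three more for each newly known location; so at most
three touched bins for each of these satisfy a property `Q` that fails for all bins of `S`. -/
theorem Ends.forList_process {I : Fin 3 → Fin b → Fin n} {F : Cube n → ℝ} (f : Cube n → ℝ)
    (hb : b ≤ n) (s : State 3 b n n) (S : List (Entry 3 b n)) (hs : Valid I F s)
    (hS : Entries I F s.known S) (Q : Bin 3 b → Bool) (hQ : ∀ x ∈ S, Q x.1 = false) :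
    Ends f (Prog.forList S (process (fun c => coordMatrix (I c)) (fun _ => idMatrix n)) (s, []))
      (fun sT => Valid I F sT.1 ∧ (∀ x ∈ S, x.1 ∈ sT.2 ∧ sT.1.known x.2.1 = true) ∧
        (∀ k, s.known k = true → sT.1.known k = true) ∧
        (∀ k, sT.1.known k = true → s.known k = false → ∀ c, (c, k ∘ I c) ∈ sT.2) ∧
        sT.2.length + 3 * unknownCount F sT.1.known ≤ S.length + 3 * unknownCount F s.known ∧
        sT.2.countP Q + 3 * unknownCount F sT.1.known ≤ 3 * unknownCount F s.known)
      (S.length * (40 * (n + 1) ^ 2 + 1)) 0 := by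
  refine (Ends.forList (q := 0) (I := fun l (sT : State 3 b n n × List (Bin 3 b)) =>
      (∀ x ∈ l, x ∈ S) ∧ Valid I F sT.1 ∧
        (∀ x ∈ S, x ∈ l ∨ (x.1 ∈ sT.2 ∧ sT.1.known x.2.1 = true)) ∧
        (∀ k, s.known k = true → sT.1.known k = true) ∧
        (∀ k, sT.1.known k = true → s.known k = false → ∀ c, (c, k ∘ I c) ∈ sT.2) ∧
        sT.2.length + 3 * unknownCount F sT.1.known + l.length ≤
          S.length + 3 * unknownCount F s.known ∧
        sT.2.countP Q + 3 * unknownCount F sT.1.known ≤ 3 * unknownCount F s.known)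
    ?_ S ?_).mono ?_ le_rfl (by omega)
  · rintro x l ⟨s', T⟩ ⟨hl, hV, hdone, hmono, hnew, hlen, hcount⟩
    have hxS := hl x (by simp)
    have hQx := hQ x hxS
    simp only [List.length_cons] at hlen
    simp only at hV hdone hmono hnew hcount
    rcases hk : s'.known x.2.1 with _ | _
    · have hF := (residual_ne_zero.1 (hS x hxS).1.1).2
      refine (Ends.process_unknown f hb x s' T hV hk (hS x hxS).2 hF).mono ?_ le_rfl le_rfl
      rintro ⟨s₂, T₂⟩ ⟨hV₂, hk₂, L, hT₂, hL3, hLmem⟩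
      simp only at hV₂ hk₂ hT₂
      subst hT₂
      have hcnt := unknownCount_update hF hk
      rw [← hk₂] at hcnt
      have hmono₂ : ∀ k, s'.known k = true → s₂.known k = true := by
        intro k h
        rw [hk₂]
        by_cases hkx : k = x.2.1
        · subst hkx; simp
        · rwa [Function.update_of_ne hkx]
      refine ⟨fun y hy => hl y (by simp [hy]), hV₂, fun y hy => ?_, fun k h => hmono₂ k (hmono k h),
        fun k h h' c => ?_, ?_, ?_⟩
      · rcases hdone y hy with h | ⟨h1, h2⟩
        · rcases List.mem_cons.1 h with rfl | h
          · exact .inr ⟨by simp, by simp [hk₂]⟩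
          · exact .inl h
        · exact .inr ⟨by simp [h1], hmono₂ _ h2⟩
      · simp only [hk₂] at h
        by_cases hkx : k = x.2.1
        · subst hkx
          exact List.mem_append_left _ (hLmem c)
        · rw [Function.update_of_ne hkx] at h
          exact List.mem_append_right _ (List.mem_cons_of_mem _ (hnew k h h' c))
      · simp only [List.length_append, List.length_cons]
        omega
      · have := List.countP_le_length (p := Q) (l := L)
        simp only [List.countP_append, List.countP_cons, hQx]
        simp only [Bool.false_eq_true, if_false]
        omega
    · refine (Ends.process_known f x s' T hk).mono ?_ le_rfl le_rfl
      rintro _ rfl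
      refine ⟨fun y hy => hl y (by simp [hy]), hV, fun y hy => ?_, hmono, fun k h h' c =>
        List.mem_cons_of_mem _ (hnew k h h' c), ?_, ?_⟩
      · rcases hdone y hy with h | ⟨h1, h2⟩
        · rcases List.mem_cons.1 h with rfl | h
          · exact .inr ⟨by simp, hk⟩
          · exact .inl h
        · exact .inr ⟨by simp [h1], h2⟩
      · simp only [List.length_cons]
        omega
      · simp only [List.countP_cons, hQx]
        simpa using hcount
  · exact ⟨fun _ h => h, hs, fun _ h => .inl h, fun _ h => h, fun k h h' => by simp [h'] at h,
      by simp; omega, by simp⟩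
  · rintro sT ⟨-, hV, hdone, hmono, hnew, hlen, hcount⟩
    exact ⟨hV, fun x hx => (hdone x hx).resolve_left (by simp), hmono, hnew, by simpa using hlen,
      hcount⟩

/-- Examining the bins `T` again yields an entry for each of their singletons. -/
theorem Ends.forList_scan {I : Fin 3 → Fin b → Fin n} {F : Cube n → ℝ} (f : Cube n → ℝ)
    (hb : b ≤ n) (hF : Unambiguous I F) (known : Cube n → Bool) (T : List (Bin 3 b))
    (Q : Bin 3 b → Bool) (hQ : ∀ y k, Isolated I (residual F known) y k → Q y = true) :
    Ends f (Prog.forList T (SparseMobius.scan (idDecoder n)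
      (fun c => contents (I c) (residual F known))) [])
      (fun S' => Entries I F known S' ∧
        (∀ y ∈ T, ∀ k, Isolated I (residual F known) y k → ∃ x ∈ S', x.1 = y) ∧
        S'.length ≤ T.countP Q)
      (T.length * (40 * (n + 1) ^ 2 + 1)) 0 := by
  refine (Ends.forList (q := 0) (I := fun l (S' : List (Entry 3 b n)) => Entries I F known S' ∧
        (∀ y ∈ T, y ∈ l ∨ ∀ k, Isolated I (residual F known) y k → ∃ x ∈ S', x.1 = y) ∧
        S'.length + l.countP Q ≤ T.countP Q)
    ?_ T ?_).mono ?_ le_rfl (by omega)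
  · rintro y l S' ⟨hE, hdone, hlen⟩
    refine (Ends.scan hF f hb known y S').mono ?_ le_rfl le_rfl
    rintro S₂ (⟨k, hk, rfl⟩ | ⟨hk, rfl⟩)
    · refine ⟨?_, fun z hz => ?_, ?_⟩
      · intro x hx
        rcases List.mem_cons.1 hx with rfl | hx
        · exact ⟨hk, rfl⟩
        · exact hE x hx
      · rcases hdone z hz with h | h
        · rcases List.mem_cons.1 h with rfl | h
          · exact .inr fun _ _ => ⟨_, List.mem_cons_self, rfl⟩
          · exact .inl h
        · refine .inr fun k' hk' => ?_
          obtain ⟨x, hx, h'⟩ := h k' hk'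
          exact ⟨x, List.mem_cons_of_mem _ hx, h'⟩
      · rw [List.countP_cons, if_pos (hQ y k hk)] at hlen
        simp only [List.length_cons]
        omega
    · refine ⟨hE, fun z hz => ?_, ?_⟩
      · rcases hdone z hz with h | h
        · rcases List.mem_cons.1 h with rfl | h
          · exact .inr fun k hk' => absurd ⟨k, hk'⟩ hk
          · exact .inl h
        · exact .inr h
      · rw [List.countP_cons] at hlen
        omega
  · exact ⟨fun x hx => by simp at hx, fun y hy => .inl hy, by simp⟩
  · rintro S' ⟨hE, hdone, hlen⟩
    exact ⟨hE, fun y hy => (hdone y hy).resolve_left (by simp), by simpa using hlen⟩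

/-- The running time of the main loop is paid for by a potential: a pass removes a nonzero
coefficient from the residual, empties all bins of the list `S`, and so leaves at most three
singletons for each location that it has made known. -/
theorem Ends.mainLoop {I : Fin 3 → Fin b → Fin n} {F : Cube n → ℝ} (f : Cube n → ℝ)
    (hb : b ≤ n) (hF : Unambiguous I F) (hP : Peelable I F) (t : ℕ) (s : State 3 b n n)
    (S : List (Entry 3 b n)) (hs : Valid I F s) (hS : Entries I F s.known S)
    (hC : Complete I F s.known S) (ht : unknownCount F s.known < t) :
    Ends f (mainLoop (fun c => coordMatrix (I c)) (fun _ => idMatrix n) (idDecoder n) t s S)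
      (· = some F) ((80 * (n + 1) ^ 2 + 3) * S.length +
        (360 * (n + 1) ^ 2 + 12) * unknownCount F s.known + 1) 0 := by
  classical
  induction t generalizing s S with
  | zero => omega
  | succ t ih =>
  rcases S with _ | ⟨x, S⟩
  · refine (Ends.op ?_).mono (fun _ h => h) (by omega) le_rfl
    have hres : ∀ k, residual F s.known k = 0 := by
      by_contra! hk
      obtain ⟨k₀, hk₀⟩ := hk
      obtain ⟨c, k, hkA, hk⟩ := hP (Finset.univ.filter fun k => residual F s.known k ≠ 0)
        ⟨k₀, by simpa using hk₀⟩ fun k hk => (residual_ne_zero.1 (by simpa using hk)).2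
      obtain ⟨x, hx, -⟩ := hC (c, k ∘ I c) k ⟨by simpa using hkA, rfl, fun l h1 h2 =>
        hk l (by simpa using h1) h2⟩
      simp at hx
    rw [hs.estimate]
    congr 1
    funext k
    have := hres k
    unfold residual at this
    split_ifs at this ⊢ with h
    · rfl
    · exact this.symm
  · set S₀ := x :: S with hS₀
    have hx0 : x ∈ S₀ := by simp [hS₀]
    -- Only the touched bins outside `S₀` can be singletons after the pass.
    let Q : Bin 3 b → Bool := fun y => decide (∀ x ∈ S₀, x.1 ≠ y)
    refine Ends.mono (t := S₀.length * (40 * (n + 1) ^ 2 + 1) +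
      ((80 * (n + 1) ^ 2 + 3) * S₀.length + (360 * (n + 1) ^ 2 + 12) * unknownCount F s.known + 1
        - S₀.length * (40 * (n + 1) ^ 2 + 1))) (q := 0 + 0)
      (Ends.bind (Ends.forList_process f hb s S₀ hs hS Q fun x hx => by
        simp only [Q, decide_eq_false_iff_not]
        exact fun h => h x hx rfl) ?_) (fun _ h => h) ?_ le_rfl
    · rintro ⟨s', T⟩ ⟨hV, hdone, hmono, hnew, hlen, hcount⟩
      simp only at hV hdone hmono hnew hlen hcount
      have hsub : ∀ k, residual F s'.known k ≠ 0 → residual F s.known k ≠ 0 := by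
        intro k hk
        rw [residual_ne_zero] at hk ⊢
        refine ⟨?_, hk.2⟩
        by_contra h
        rw [hmono k (by simpa using h)] at hk
        exact absurd hk.1 (by decide)
      -- The bin of each processed entry held only the location that is now known.
      have hempty : ∀ x ∈ S₀, ∀ k, ¬ Isolated I (residual F s'.known) x.1 k := by
        intro x hx k hk
        have hkx := (hS x hx).1.2.2 k (hsub k hk.1) hk.2.1
        have := (residual_ne_zero.1 hk.1).1
        rw [hkx, (hdone x hx).2] at this
        exact absurd this (by decide)
      -- A bin that is a singleton now was one before, or has lost a newly known location.
      have hT : ∀ y k, Isolated I (residual F s'.known) y k → y ∈ T := by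
        intro y k hk
        by_cases hold : Isolated I (residual F s.known) y k
        · obtain ⟨x, hx, rfl⟩ := hC y k hold
          exact (hdone x hx).1
        · have : ∃ l, residual F s.known l ≠ 0 ∧ l ∘ I y.1 = y.2 ∧ l ≠ k := by
            by_contra! h
            exact hold ⟨hsub k hk.1, hk.2.1, h⟩
          obtain ⟨l, h1, h2, h3⟩ := this
          have h4 : s'.known l = true := by
            by_contra h
            exact h3 (hk.2.2 l (residual_ne_zero.2 ⟨by simpa using h,
              (residual_ne_zero.1 h1).2⟩) h2)
          have := hnew l h4 (residual_ne_zero.1 h1).1 y.1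
          rwa [h2] at this
      have hless : unknownCount F s'.known < unknownCount F s.known := by
        refine Finset.card_lt_card ⟨fun k hk => by simpa using hsub k (by simpa using hk),
          fun h => ?_⟩
        have h1 := h (Finset.mem_filter.2 ⟨Finset.mem_univ x.2.1, (hS x hx0).1.1⟩)
        have h2 := (residual_ne_zero.1 (by simpa using h1)).1
        rw [(hdone x hx0).2] at h2
        exact absurd h2 (by decide)
      have hQ : ∀ y k, Isolated I (residual F s'.known) y k → Q y = true := by
        intro y k hk
        simp only [Q, decide_eq_true_eq]
        rintro x hx rfl
        exact hempty x hx k hk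
      refine Ends.mono (t := T.length * (40 * (n + 1) ^ 2 + 1) +
        ((80 * (n + 1) ^ 2 + 3) * T.countP Q + (360 * (n + 1) ^ 2 + 12) * unknownCount F s'.known
          + 1 + 1)) (q := 0 + 0)
        (Ends.bind (hV.bins ▸ Ends.forList_scan f hb hF s'.known T Q hQ)
          fun S' hS' => Ends.step ((ih s' S' hV hS'.1 (fun y k hk => hS'.2.1 y (hT y k hk) k hk)
            (by omega)).mono (fun _ h => h) ?_ le_rfl)) (fun _ h => h) ?_ le_rfl
      · have := hS'.2.2
        gcongr
      · obtain ⟨d, hd⟩ := Nat.exists_eq_add_of_lt hless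
        have hL : 1 ≤ S₀.length := by simp [hS₀]
        generalize unknownCount F s'.known = u' at *
        generalize (n + 1) ^ 2 = w at *
        rw [hd] at hlen hcount ⊢
        have e1 : T.length ≤ S₀.length + 3 * (d + 1) := by omega
        have e2 : T.countP Q ≤ 3 * (d + 1) := by omega
        generalize S₀.length = a at *
        have e3 := Nat.mul_le_mul_right (40 * w + 1) e1
        have e4 := Nat.mul_le_mul_left (80 * w + 3) e2
        refine Nat.le_sub_of_add_le ?_
        nlinarith
    · generalize (n + 1) ^ 2 = w
      generalize S₀.length = a
      have : a * (40 * w + 1) ≤ (80 * w + 3) * a := by nlinarith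
      omega

/-- If no bin is ever mistaken for a singleton, and peeling succeeds, then the Sparse Möbius
Transform is exact, and its cost is linear in the number of bins and of nonzero coefficients. -/
theorem Ends.smt {I : Fin 3 → Fin b → Fin n} {f : Cube n → ℝ} (hb : b ≤ n)
    (hF : Unambiguous I (mobius f)) (hP : Peelable I (mobius f)) (K : ℕ)
    (hK : (Finset.univ.filter fun k => mobius f k ≠ 0).card = K) :
    Ends f (smt (fun c => coordMatrix (I c)) (fun _ => idMatrix n) (idDecoder n) (K + 1))
      (· = some (mobius f)) (1000 * (n + 1) ^ 2 * (2 ^ b + K)) (3 * ((n + 1) * 2 ^ b)) := by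
  have hres : residual (mobius f) (fun _ => false) = mobius f := by
    funext k; simp [residual]
  have hunk : unknownCount (mobius f) (fun _ => false) = K := by
    rw [unknownCount, hres, hK]
  refine Ends.mono (t := 3 * (20 * (n + 1) ^ 2 * 2 ^ b + 1) +
    (3 * (2 ^ b * (40 * (n + 1) ^ 2 + 2) + 1) + ((80 * (n + 1) ^ 2 + 3) * (3 * 2 ^ b) +
      (360 * (n + 1) ^ 2 + 12) * K + 1))) (q := 3 * ((n + 1) * 2 ^ b) + (3 * (2 ^ b * 0) + 0))
    (Ends.bind (Ends.tabulate_eq fun c => Ends.subsample (I c) f hb) fun U hU =>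
      Ends.bind (Ends.forFin (I := fun i (S : List (Entry 3 b n)) =>
        Entries I (mobius f) (fun _ => false) S ∧
        (∀ y : Bin 3 b, (y.1 : ℕ) < i → ∀ k, Isolated I (mobius f) y k → ∃ x ∈ S, x.1 = y) ∧
        S.length ≤ i * 2 ^ b) (fun c S hS => ?_) ?_) fun S hS => ?_)
    (fun _ h => h) ?_ (by omega)
  · refine (Ends.forCube (q := 0) (t := 40 * (n + 1) ^ 2)
      (I := fun A (S : List (Entry 3 b n)) =>
      Entries I (mobius f) (fun _ => false) S ∧
      (∀ y : Bin 3 b, ((y.1 : ℕ) < c ∨ (y.1 = c ∧ y.2 ∈ A)) →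
        ∀ k, Isolated I (mobius f) y k → ∃ x ∈ S, x.1 = y) ∧
      S.length ≤ c * 2 ^ b + A.card) (fun A j S hj hS => ?_) ?_).mono ?_ le_rfl le_rfl
    · have hscan := Ends.scan hF f hb (fun _ => false) (c, j) S
      rw [hres, ← hU] at hscan
      refine hscan.mono ?_ le_rfl le_rfl
      obtain ⟨hE, hdone, hlen⟩ := hS
      rintro S₂ (⟨k, hk, rfl⟩ | ⟨hk, rfl⟩)
      · refine ⟨?_, fun z hz k' hk' => ?_, ?_⟩
        · intro x hx
          rcases List.mem_cons.1 hx with rfl | hx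
          · exact ⟨hres.symm ▸ hk, rfl⟩
          · exact hE x hx
        · by_cases hzc : z = (c, j)
          · exact ⟨_, List.mem_cons_self, hzc.symm⟩
          · have : (z.1 : ℕ) < c ∨ (z.1 = c ∧ z.2 ∈ A) := by
              rcases hz with hz | ⟨hz1, hz2⟩
              · exact .inl hz
              · refine .inr ⟨hz1, (Finset.mem_insert.1 hz2).resolve_left fun h => ?_⟩
                exact hzc (Prod.ext hz1 h)
            obtain ⟨x, hx, h'⟩ := hdone z this k' hk'
            exact ⟨x, List.mem_cons_of_mem _ hx, h'⟩
        · rw [Finset.card_insert_of_notMem hj, List.length_cons]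
          omega
      · refine ⟨hE, fun z hz k' hk' => ?_, hlen.trans (by
          rw [Finset.card_insert_of_notMem hj]; omega)⟩
        by_cases hzc : z = (c, j)
        · exact absurd ⟨k', hzc ▸ hk'⟩ hk
        · refine hdone z ?_ k' hk'
          rcases hz with hz | ⟨hz1, hz2⟩
          · exact .inl hz
          · refine .inr ⟨hz1, (Finset.mem_insert.1 hz2).resolve_left fun h => ?_⟩
            exact hzc (Prod.ext hz1 h)
    · exact ⟨hS.1, fun y hy => hS.2.1 y (hy.resolve_right (by simp)), by simpa using hS.2.2⟩
    · rintro S' ⟨h1, h2, h3⟩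
      refine ⟨h1, fun y hy => h2 y ?_, ?_⟩
      · rcases Nat.lt_succ_iff_lt_or_eq.1 hy with h | h
        · exact .inl h
        · exact .inr ⟨Fin.ext h, Finset.mem_univ _⟩
      · rw [Finset.card_univ, Fintype.card_fun, Fintype.card_bool, Fintype.card_fin] at h3
        rw [Nat.succ_mul]
        exact h3
  · exact ⟨fun x hx => by simp at hx, fun y hy => by simp at hy, by simp⟩
  · obtain ⟨hE, hC, hlen⟩ := hS
    refine (Ends.mainLoop f hb hF hP (K + 1) ⟨U, fun _ => 0, fun _ => false⟩ S
      ⟨by simp only [hres]; exact hU, by simp, by simp⟩ hE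
      (fun y k hk => hC y y.1.2 k (by rwa [hres] at hk)) (by simp [hunk])).mono
      (fun _ h => h) ?_ le_rfl
    simp only [hunk]
    gcongr
  · have h1 : 1 ≤ 2 ^ b := Nat.one_le_two_pow
    have h2 : 1 ≤ (n + 1) ^ 2 := Nat.one_le_pow _ _ (by omega)
    generalize 2 ^ b = M at *
    generalize (n + 1) ^ 2 = w at *
    have h3 : M ≤ w * M := Nat.le_mul_of_pos_left _ h2
    have h4 : K ≤ w * K := Nat.le_mul_of_pos_left _ h2
    nlinarith

end

/-! ### Cores of random points -/

section

open Finset in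
/-- The number of points of a cube whose coordinates at `J x` are prescribed. -/
theorem card_prescribed {α β : Type*} [Fintype α] [DecidableEq α] [Fintype β]
    (J : β ↪ α) (y : β → Bool) :
    #{k : α → Bool | k ∘ J = y} * 2 ^ Fintype.card β = 2 ^ Fintype.card α := by
  classical
  have hset : ({k : α → Bool | k ∘ J = y} : Finset (α → Bool)) =
      Fintype.piFinset fun i => univ.filter fun v => ∀ x, J x = i → v = y x := by
    ext k
    simp only [mem_filter, mem_univ, true_and, Fintype.mem_piFinset, funext_iff,
      Function.comp_apply]
    exact ⟨fun h i x hx => hx ▸ h x, fun h x => h _ x rfl⟩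
  have hcard : ∀ i, #(univ.filter fun v : Bool => ∀ x, J x = i → v = y x) *
      (if i ∈ univ.map J then 2 else 1) = 2 := by
    intro i
    split_ifs with h
    · obtain ⟨x, -, rfl⟩ := mem_map.1 h
      have : (univ.filter fun v : Bool => ∀ x', J x' = J x → v = y x') = {y x} := by
        ext v
        simp only [mem_filter, mem_univ, true_and, mem_singleton]
        exact ⟨fun h => h x rfl, fun h x' hx' => by rw [J.injective hx', h]⟩
      rw [this]
      rfl
    · have : (univ.filter fun v : Bool => ∀ x, J x = i → v = y x) = univ := by
        ext v
        simp only [mem_filter, mem_univ, true_and, iff_true]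
        exact fun x hx => absurd (mem_map.2 ⟨x, mem_univ _, hx⟩) h
      rw [this]
      rfl
  have hpow : (2 : ℕ) ^ Fintype.card β = ∏ i, if i ∈ univ.map J then 2 else 1 := by
    rw [prod_ite_mem, univ_inter, prod_const, card_map, card_univ]
  rw [hset, Fintype.card_piFinset, hpow, ← prod_mul_distrib, prod_congr rfl fun i _ => hcard i,
    prod_const, card_univ]

variable {n b K : ℕ}

/-- The union of three disjoint blocks of coordinates. -/
def blocks (I : Fin 3 → Fin b ↪ Fin n)
    (hI : ∀ c₁ c₂, c₁ ≠ c₂ → Disjoint (Set.range (I c₁)) (Set.range (I c₂))) :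
    Fin 3 × Fin b ↪ Fin n where
  toFun x := I x.1 x.2
  inj' := by
    rintro ⟨c, j⟩ ⟨c', j'⟩ h
    by_cases hc : c = c'
    · subst hc
      simpa using h
    · exact ((Set.disjoint_left.1 (hI c c' hc)) ⟨j, rfl⟩ ⟨j', h.symm⟩).elim

open Finset in
/-- The bins of a uniformly random point in the three groups are independent and uniform. -/
theorem card_bins (I : Fin 3 → Fin b ↪ Fin n)
    (hI : ∀ c₁ c₂, c₁ ≠ c₂ → Disjoint (Set.range (I c₁)) (Set.range (I c₂)))
    (T : Fin 3 → Finset (Cube b)) :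
    #{k : Cube n | ∀ c, k ∘ I c ∈ T c} * (2 ^ b) ^ 3 = 2 ^ n * ∏ c, #(T c) := by
  classical
  have hfib : ∀ y : Fin 3 → Cube b, #{k : Cube n | (fun c => k ∘ I c) = y} * (2 ^ b) ^ 3 = 2 ^ n := by
    intro y
    have := card_prescribed (blocks I hI) fun x => y x.1 x.2
    simp only [Fintype.card_prod, Fintype.card_fin] at this
    rw [← pow_mul, mul_comm b 3, ← this]
    congr 2
    ext k
    simp only [mem_filter, mem_univ, true_and, funext_iff, Prod.forall]
    rfl
  have : #{k : Cube n | ∀ c, k ∘ I c ∈ T c} =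
      ∑ y ∈ Fintype.piFinset T, #{k : Cube n | (fun c => k ∘ I c) = y} := by
    rw [card_eq_sum_card_fiberwise (t := Fintype.piFinset T) (f := fun k c => k ∘ I c)]
    · refine sum_congr rfl fun y hy => ?_
      rw [filter_filter]
      congr 1
      ext k
      simp only [mem_filter, mem_univ, true_and, and_iff_right_iff_imp]
      rintro rfl
      simpa using hy
    · intro k hk
      simpa using hk
  rw [this, sum_mul, sum_congr rfl fun y _ => hfib y, sum_const, smul_eq_mul,
    Fintype.card_piFinset, mul_comm]

/-- The points with indices in `A` form a core: in each group, each of them shares its bin with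
another one. -/
def IsCore (I : Fin 3 → Fin b ↪ Fin n) (A : Finset (Fin K)) (κ : Fin K → Cube n) : Prop :=
  ∀ c, ∀ i ∈ A, ∃ j ∈ A, j ≠ i ∧ κ j ∘ I c = κ i ∘ I c

open Finset in
/-- A core of `s` points occupies at most `s / 2` bins in each group, so that a union bound over the
sets of occupied bins estimates the number of cores. -/
theorem card_isCore_le (I : Fin 3 → Fin b ↪ Fin n)
    (hI : ∀ c₁ c₂, c₁ ≠ c₂ → Disjoint (Set.range (I c₁)) (Set.range (I c₂)))
    (hK : K ≤ 2 ^ b) (A : Finset (Fin K)) [DecidablePred (IsCore I A)] :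
    #{κ : Fin K → Cube n | IsCore I A κ} * ((2 ^ b) ^ #A) ^ 3 ≤
      ((2 ^ b).choose (#A / 2) * (#A / 2) ^ #A) ^ 3 * (2 ^ n) ^ K := by
  classical
  set r := #A / 2 with hr
  have hA : #A ≤ K := by simpa using card_le_univ A
  have hcover : ({κ : Fin K → Cube n | IsCore I A κ} : Finset _) ⊆
      (Fintype.piFinset fun _ : Fin 3 => powersetCard r (univ : Finset (Cube b))).biUnion
        fun T => Fintype.piFinset fun i => if i ∈ A then
          ({k : Cube n | ∀ c, k ∘ I c ∈ T c} : Finset (Cube n)) else univ := by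
    intro κ hκ
    have hκ : IsCore I A κ := by simpa using hκ
    have hT : ∀ c, ∃ T : Finset (Cube b), (A.image fun i => κ i ∘ I c) ⊆ T ∧ #T = r := by
      intro c
      have h2 : 2 * #(A.image fun i => κ i ∘ I c) ≤ #A := by
        refine mul_card_image_le_card _ _ fun y hy => ?_
        obtain ⟨i, hi, rfl⟩ := mem_image.1 hy
        obtain ⟨j, hj, hji, h⟩ := hκ c i hi
        exact one_lt_card.2 ⟨i, by simp [hi], j, by simp [hj, h], hji.symm⟩
      obtain ⟨T, h1, h3⟩ := exists_superset_card_eq (s := A.image fun i => κ i ∘ I c) (n := r)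
        (by omega) (by simp; omega)
      exact ⟨T, h1, h3⟩
    choose T hT1 hT2 using hT
    refine mem_biUnion.2 ⟨T, by simp [mem_powersetCard, hT2], ?_⟩
    rw [Fintype.mem_piFinset]
    intro i
    split_ifs with hi
    · simp only [mem_filter, mem_univ, true_and]
      exact fun c => hT1 c (mem_image_of_mem _ hi)
    · exact mem_univ _
  have hone : ∀ T ∈ Fintype.piFinset fun _ : Fin 3 => powersetCard r (univ : Finset (Cube b)),
      #(Fintype.piFinset fun i : Fin K => if i ∈ A then
          ({k : Cube n | ∀ c, k ∘ I c ∈ T c} : Finset (Cube n)) else univ) * ((2 ^ b) ^ #A) ^ 3 =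
        (r ^ #A) ^ 3 * (2 ^ n) ^ K := by
    intro T hT
    have hTr : ∀ c, #(T c) = r := by
      intro c
      have := Fintype.mem_piFinset.1 hT c
      exact (mem_powersetCard.1 this).2
    have hbins := card_bins I hI T
    simp only [hTr, prod_const, card_univ, Fintype.card_fin] at hbins
    have hcard : ∀ i : Fin K, #(if i ∈ A then
        ({k : Cube n | ∀ c, k ∘ I c ∈ T c} : Finset (Cube n)) else univ) *
          (if i ∈ A then (2 ^ b) ^ 3 else 1) = 2 ^ n * if i ∈ A then r ^ 3 else 1 := by
      intro i
      split_ifs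
      · exact hbins
      · simp
    have hp : ∀ a : ℕ, (a ^ #A) ^ 3 = ∏ i : Fin K, if i ∈ A then a ^ 3 else 1 := by
      intro a
      rw [prod_ite_mem, univ_inter, prod_const, ← pow_mul, ← pow_mul, mul_comm]
    rw [hp, hp, Fintype.card_piFinset, ← prod_mul_distrib, prod_congr rfl fun i _ => hcard i,
      prod_mul_distrib, prod_const, card_univ, Fintype.card_fin, mul_comm]
  calc _ ≤ (∑ T ∈ Fintype.piFinset fun _ : Fin 3 => powersetCard r (univ : Finset (Cube b)),
        #(Fintype.piFinset fun i : Fin K => if i ∈ A then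
          ({k : Cube n | ∀ c, k ∘ I c ∈ T c} : Finset (Cube n)) else univ)) *
            ((2 ^ b) ^ #A) ^ 3 :=
        Nat.mul_le_mul_right _ ((card_le_card hcover).trans card_biUnion_le)
    _ = _ := by
        rw [sum_mul, sum_congr rfl hone, sum_const, Fintype.card_piFinset]
        simp only [card_powersetCard, card_univ, Fintype.card_fun, Fintype.card_bool,
          Fintype.card_fin, prod_const, smul_eq_mul]
        ring

theorem pow_self_le_three_pow_mul_factorial (r : ℕ) : (r : ℝ) ^ r ≤ 3 ^ r * r.factorial := by
  have h := Real.pow_div_factorial_le_exp (r : ℝ) (by positivity) r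
  rw [div_le_iff₀ (by positivity)] at h
  refine h.trans ?_
  gcongr
  rw [← Real.exp_one_pow]
  gcongr
  exact Real.exp_one_lt_three.le

/-- With at least `18 K` bins in each group, cores of `s` points have total probability at most
`s 2^{-s} / (36 K)`. -/
theorem choose_mul_core_bound {K M s : ℕ} (hM : 18 * K ≤ M) (hs : 1 ≤ s) (hsK : s ≤ K) :
    (K.choose s : ℝ) * (((M.choose (s / 2) * (s / 2) ^ s : ℕ) : ℝ) / M ^ s) ^ 3 ≤
      s * (1 / 2) ^ s / (36 * K) := by
  rcases Nat.lt_or_ge s 2 with h1 | hs2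
  · -- A single point is never a core, and `s / 2 = 0` makes the bound vanish.
    obtain rfl : s = 1 := by omega
    norm_num
    positivity
  set r := s / 2 with hr
  have hr2 : 2 * r ≤ s := by omega
  have hK0 : (0 : ℝ) < K := by exact_mod_cast (by omega : 0 < K)
  have hMK : (18 : ℝ) * K ≤ M := by exact_mod_cast hM
  have hM0 : (0 : ℝ) < M := by linarith
  set q : ℝ := r / M with hq
  have hq0 : 0 ≤ q := by positivity
  have hrs : (r : ℝ) ≤ s / 2 := by
    rw [le_div_iff₀ (by norm_num)]
    exact_mod_cast (by omega : r * 2 ≤ s)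
  have hqs : q ≤ s / (36 * K) := by
    calc q ≤ (s / 2) / (18 * K) := by rw [hq]; gcongr
      _ = s / (36 * K) := by field_simp; norm_num
  have hq1 : q ≤ 1 := by
    rw [hq, div_le_one hM0]
    exact_mod_cast (by omega : r ≤ M)
  have hocc : ((M.choose r * r ^ s : ℕ) : ℝ) / M ^ s ≤ 3 ^ r * q ^ (s - r) := by
    have h1 : (M.choose r : ℝ) ≤ M ^ r / r.factorial := Nat.choose_le_pow_div r M
    have h2 := pow_self_le_three_pow_mul_factorial r
    have hf : (0 : ℝ) < r.factorial := by positivity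
    have h3 : (M.choose r : ℝ) * r ^ r ≤ 3 ^ r * M ^ r := by
      calc (M.choose r : ℝ) * r ^ r ≤ M ^ r / r.factorial * (3 ^ r * r.factorial) := by gcongr
        _ = 3 ^ r * M ^ r := by field_simp
    have hsplit : s = r + (s - r) := by omega
    have e1 : (r : ℝ) ^ s = r ^ r * r ^ (s - r) := by rw [← pow_add, ← hsplit]
    have e2 : (M : ℝ) ^ s = M ^ r * M ^ (s - r) := by rw [← pow_add, ← hsplit]
    rw [Nat.cast_mul, Nat.cast_pow, e1, e2, hq, div_pow, div_le_iff₀ (by positivity)]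
    calc (M.choose r : ℝ) * (r ^ r * r ^ (s - r)) = (M.choose r * r ^ r) * r ^ (s - r) := by ring
      _ ≤ 3 ^ r * M ^ r * r ^ (s - r) := by gcongr
      _ = _ := by field_simp
  have hcube : (((M.choose r * r ^ s : ℕ) : ℝ) / M ^ s) ^ 3 ≤ 6 ^ s * (s / (36 * K)) ^ (s + 1) := by
    calc _ ≤ (3 ^ r * q ^ (s - r)) ^ 3 := by gcongr
      _ = 27 ^ r * q ^ (3 * (s - r)) := by
        rw [mul_pow, ← pow_mul, ← pow_mul, mul_comm r 3, pow_mul, mul_comm (s - r)]; norm_num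
      _ ≤ 36 ^ r * q ^ (s + 1) := by
        gcongr ?_ * ?_
        · gcongr; norm_num
        · -- `3 (s - r) ≥ s + 1`, since `2 r ≤ s` and `s ≥ 2`.
          exact pow_le_pow_of_le_one hq0 hq1 (by omega)
      _ = 6 ^ (2 * r) * q ^ (s + 1) := by rw [pow_mul]; norm_num
      _ ≤ 6 ^ s * (s / (36 * K)) ^ (s + 1) := by gcongr; norm_num
  have h1 : (K.choose s : ℝ) ≤ K ^ s / s.factorial := Nat.choose_le_pow_div s K
  have h2 := pow_self_le_three_pow_mul_factorial s
  calc _ ≤ (K ^ s / s.factorial : ℝ) * (6 ^ s * (s / (36 * K)) ^ (s + 1)) := by gcongr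
    _ = (s : ℝ) ^ s / s.factorial * (1 / 6) ^ s * (s / (36 * K)) := by
      rw [pow_succ, div_pow, mul_pow, one_div, inv_pow,
        show (36 : ℝ) ^ s = 6 ^ s * 6 ^ s by rw [← mul_pow]; norm_num]
      field_simp
    _ ≤ 3 ^ s * (1 / 6) ^ s * (s / (36 * K)) := by
      gcongr
      rw [div_le_iff₀ (by positivity)]
      exact h2
    _ = _ := by
      rw [← mul_pow]
      norm_num
      ring

theorem sum_range_mul_half_pow_le (m : ℕ) :
    ∑ s ∈ Finset.range m, (s : ℝ) * (1 / 2) ^ s ≤ 2 := by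
  suffices h : ∑ s ∈ Finset.range m, (s : ℝ) * (1 / 2) ^ s = 2 - (m + 1) * 2 * (1 / 2) ^ m by
    rw [h]
    have : (0 : ℝ) ≤ (m + 1) * 2 * (1 / 2) ^ m := by positivity
    linarith
  induction m with
  | zero => norm_num
  | succ m ih =>
    rw [Finset.sum_range_succ, ih]
    push_cast
    ring

open Finset in
/-- Among `K`-tuples of points, those that contain a core have probability at most
`1 / (18 K)`. -/
theorem card_exists_isCore_le (I : Fin 3 → Fin b ↪ Fin n)
    (hI : ∀ c₁ c₂, c₁ ≠ c₂ → Disjoint (Set.range (I c₁)) (Set.range (I c₂)))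
    (hK : 1 ≤ K) (hM : 18 * K ≤ 2 ^ b)
    [DecidablePred fun κ : Fin K → Cube n => ∃ A : Finset (Fin K), A.Nonempty ∧ IsCore I A κ] :
    (#{κ : Fin K → Cube n | ∃ A : Finset (Fin K), A.Nonempty ∧ IsCore I A κ} : ℝ) ≤
      1 / (18 * K) * (2 ^ n) ^ K := by
  classical
  have hK0 : (0 : ℝ) < K := by exact_mod_cast hK
  -- The empty set is excluded: for `s = 0` the bound would be `0 ^ 0 = 1`.
  let g : ℕ → ℝ := fun s => if s = 0 then 0 else
    ((((2 ^ b).choose (s / 2) * (s / 2) ^ s : ℕ) : ℝ) / ((2 ^ b : ℕ) : ℝ) ^ s) ^ 3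
  have hA : ∀ A : Finset (Fin K), A.Nonempty →
      (#{κ : Fin K → Cube n | IsCore I A κ} : ℝ) ≤ g #A * (2 ^ n) ^ K := by
    intro A hne
    have h := card_isCore_le I hI (by omega) A
    have h' : (#{κ : Fin K → Cube n | IsCore I A κ} : ℝ) * (((2 ^ b : ℕ) : ℝ) ^ #A) ^ 3 ≤
      (((2 ^ b).choose (#A / 2) * (#A / 2) ^ #A : ℕ) : ℝ) ^ 3 * (2 ^ n) ^ K := by exact_mod_cast h
    rw [← le_div_iff₀ (by positivity)] at h'
    refine h'.trans (le_of_eq ?_)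
    simp only [g, if_neg hne.card_pos.ne', div_pow]
    ring
  have hsub : ({κ : Fin K → Cube n | ∃ A : Finset (Fin K), A.Nonempty ∧ IsCore I A κ} :
      Finset _) ⊆ (univ.filter fun A : Finset (Fin K) => A.Nonempty).biUnion
        fun A => {κ : Fin K → Cube n | IsCore I A κ} := by
    intro κ hκ
    simpa using hκ
  calc (#{κ : Fin K → Cube n | ∃ A : Finset (Fin K), A.Nonempty ∧ IsCore I A κ} : ℝ)
      ≤ ∑ A : Finset (Fin K) with A.Nonempty, (#{κ : Fin K → Cube n | IsCore I A κ} : ℝ) := by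
        exact_mod_cast (card_le_card hsub).trans card_biUnion_le
    _ ≤ ∑ A : Finset (Fin K) with A.Nonempty, g #A * (2 ^ n) ^ K :=
        sum_le_sum fun A h => hA A (mem_filter.1 h).2
    _ ≤ ∑ A : Finset (Fin K), g #A * (2 ^ n) ^ K := by
        refine sum_le_sum_of_subset_of_nonneg (filter_subset _ _) fun A _ _ => ?_
        simp only [g]
        split_ifs <;> positivity
    _ = (∑ s ∈ range (K + 1), K.choose s * g s) * (2 ^ n) ^ K := by
        rw [← sum_mul, ← powerset_univ, sum_powerset_apply_card]
        simp
    _ ≤ (∑ s ∈ range (K + 1), (s : ℝ) * (1 / 2) ^ s / (36 * K)) * (2 ^ n) ^ K := by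
        gcongr with s hs
        rcases Nat.eq_zero_or_pos s with rfl | h0
        · simp [g]
        · simp only [g, if_neg h0.ne']
          exact choose_mul_core_bound hM h0 (by simp at hs; omega)
    _ ≤ 2 / (36 * K) * (2 ^ n) ^ K := by
        rw [← sum_div]
        gcongr
        exact sum_range_mul_half_pow_le _
    _ = _ := by congr 1; field_simp; norm_num

end

/-! ### False singletons, and sampling without replacement -/

section

variable {n b K : ℕ}

/-- Flip the coordinates `i` and `j` of `x` if the bits `p` and `q`, respectively, are set. -/
def flipTwo (i j : Fin K) (p q : Bool) (x : Cube K) : Cube K := fun l =>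
  xor (x l) (if l = i then p else if l = j then q else false)

theorem flipTwo_flipTwo (i j : Fin K) (p q : Bool) (x : Cube K) :
    flipTwo i j p q (flipTwo i j p q x) = x := by
  funext l
  simp only [flipTwo]
  split_ifs <;> simp

open Finset in
/-- If at least two nonzero reals are selected by independent fair bits, then the selected sum is `0`
or the total with probability at most `3 / 4`: among the four settings of two of the bits, one
avoids both values. -/
theorem card_ratio_le (A : Finset (Fin K)) (v : Fin K → ℝ) (hv : ∀ i, v i ≠ 0) (hA : 2 ≤ #A) :
    4 * #{x : Cube K | ∑ i ∈ A with x i = false, v i = 0 ∨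
      ∑ i ∈ A with x i = false, v i = ∑ i ∈ A, v i} ≤ 3 * 2 ^ K := by
  classical
  obtain ⟨i, hi, j, hj, hij⟩ := one_lt_card.1 hA
  set V := ∑ i ∈ A, v i with hVdef
  set G : Finset (Cube K) := {x : Cube K | ∑ i ∈ A with x i = false, v i = 0 ∨
      ∑ i ∈ A with x i = false, v i = V} with hG
  have hsum : ∀ x : Cube K, ∑ l ∈ A with x l = false, v l =
      (if x i = false then v i else 0) + ((if x j = false then v j else 0) +
        ∑ l ∈ (A.erase i).erase j, if x l = false then v l else 0) := by
    intro x
    rw [sum_filter, ← add_sum_erase A _ hi, ← add_sum_erase (A.erase i) _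
      (mem_erase.2 ⟨hij.symm, hj⟩)]
  have hsome : ∀ x : Cube K, ∃ p q, flipTwo i j p q x ∉ G := by
    intro x
    by_contra! h
    set s := ∑ l ∈ (A.erase i).erase j, if x l = false then v l else 0 with hs
    have hrest : ∀ p q, ∑ l ∈ (A.erase i).erase j, (if flipTwo i j p q x l = false then v l else 0)
        = s := by
      intro p q
      refine sum_congr rfl fun l hl => ?_
      have h1 : l ≠ j := ne_of_mem_erase hl
      have h2 : l ≠ i := ne_of_mem_erase (mem_of_mem_erase hl)
      simp [flipTwo, h1, h2]
    have hval : ∀ p q, ((if (xor (x i) p) = false then v i else 0) +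
        ((if (xor (x j) q) = false then v j else 0) + s) = 0) ∨
        ((if (xor (x i) p) = false then v i else 0) +
        ((if (xor (x j) q) = false then v j else 0) + s) = V) := by
      intro p q
      have := h p q
      simp only [hG, mem_filter, mem_univ, true_and, hsum, hrest] at this
      simpa [flipTwo, hij.symm] using this
    have hall : ∀ p q : Bool, ((if p = false then v i else 0) +
        ((if q = false then v j else 0) + s) = 0) ∨ ((if p = false then v i else 0) +
        ((if q = false then v j else 0) + s) = V) := by
      intro p q
      have := hval (xor (x i) p) (xor (x j) q)
      simpa only [← Bool.xor_assoc, Bool.xor_self, Bool.false_xor] using this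
    have h00 := hall true true
    have h01 := hall true false
    have h10 := hall false true
    have h11 := hall false false
    simp only [Bool.true_eq_false, if_false, if_true, zero_add] at h00 h01 h10 h11
    have hvi := hv i
    have hvj := hv j
    rcases h00 with h00 | h00 <;> rcases h01 with h01 | h01 <;> rcases h10 with h10 | h10 <;>
      rcases h11 with h11 | h11 <;>
      first
        | exact hvi (by linarith)
        | exact hvj (by linarith)
  have hcount : 2 ^ K ≤ 4 * #Gᶜ := by
    have hcov : (univ : Finset (Cube K)) ⊆ (univ : Finset (Bool × Bool)).biUnion
        fun w => Gᶜ.image (flipTwo i j w.1 w.2) := by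
      intro x _
      obtain ⟨p, q, h⟩ := hsome x
      exact mem_biUnion.2 ⟨(p, q), mem_univ _, mem_image.2
        ⟨_, mem_compl.2 h, flipTwo_flipTwo i j p q x⟩⟩
    have := (card_le_card hcov).trans
      (card_biUnion_le_card_mul _ _ #Gᶜ fun w _ => card_image_le)
    simpa using this
  have htot := card_add_card_compl G
  rw [Fintype.card_fun, Fintype.card_bool, Fintype.card_fin] at htot
  omega

open Finset in
theorem card_constant_le (A : Finset (Fin K)) :
    #{x : Cube K | ∀ i ∈ A, ∀ j ∈ A, x i = x j} * 2 ^ #A ≤ 2 * 2 ^ K := by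
  classical
  have hsub : ({x : Cube K | ∀ i ∈ A, ∀ j ∈ A, x i = x j} : Finset _) ⊆
      (univ : Finset Bool).biUnion fun w =>
        {x : Cube K | x ∘ Function.Embedding.subtype (· ∈ A) = fun _ => w} := by
    intro x hx
    have hx : ∀ i ∈ A, ∀ j ∈ A, x i = x j := by simpa using hx
    rcases A.eq_empty_or_nonempty with rfl | ⟨i, hi⟩
    · refine mem_biUnion.2 ⟨true, mem_univ _, ?_⟩
      simp only [mem_filter, mem_univ, true_and]
      funext y
      exact absurd y.2 (notMem_empty _)
    · refine mem_biUnion.2 ⟨x i, mem_univ _, ?_⟩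
      simp only [mem_filter, mem_univ, true_and]
      funext y
      exact hx y y.2 i hi
  calc _ ≤ (∑ w : Bool, #{x : Cube K | x ∘ Function.Embedding.subtype (· ∈ A) = fun _ => w}) *
        2 ^ #A := Nat.mul_le_mul_right _ ((card_le_card hsub).trans card_biUnion_le)
    _ = _ := by
      rw [sum_mul]
      have := fun w : Bool => card_prescribed (Function.Embedding.subtype (· ∈ A)) fun _ => w
      simp only [Fintype.card_coe, Fintype.card_fin] at this
      rw [sum_congr rfl fun w _ => this w]
      simp

/-- The points with indices in `A`, with the values `v`, share a bin of the group `c` and look like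
a singleton there. -/
def IsFake (I : Fin 3 → Fin b ↪ Fin n) (v : Fin K → ℝ) (c : Fin 3) (A : Finset (Fin K))
    (κ : Fin K → Cube n) : Prop :=
  (∀ i ∈ A, ∀ j ∈ A, κ i ∘ I c = κ j ∘ I c) ∧ ∀ p, ∑ i ∈ A with κ i p = false, v i = 0 ∨
    ∑ i ∈ A with κ i p = false, v i = ∑ i ∈ A, v i

open Finset in
/-- The `p`-th coordinates of all points are independent for different `p`; those in the range of
`I c` have to be constant on `A`, the others have to give a ratio in `{0, 1}`. -/
theorem card_isFake_le (I : Fin 3 → Fin b ↪ Fin n) (v : Fin K → ℝ) (hv : ∀ i, v i ≠ 0)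
    (c : Fin 3) (A : Finset (Fin K)) (hA : 2 ≤ #A)
    [DecidablePred (IsFake I v c A)] :
    #{κ : Fin K → Cube n | IsFake I v c A κ} * (2 ^ b) ^ #A * 4 ^ (n - b) ≤
      2 ^ b * 3 ^ (n - b) * (2 ^ n) ^ K := by
  classical
  have hbn : b ≤ n := by simpa using Fintype.card_le_of_embedding (I c)
  let R : Finset (Fin n) := univ.map (I c)
  have hR : #R = b := by simp [R]
  have hRc : #Rᶜ = n - b := by rw [card_compl, hR, Fintype.card_fin]
  set C₁ : Finset (Cube K) := {x : Cube K | ∀ i ∈ A, ∀ j ∈ A, x i = x j} with hC₁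
  set G : Finset (Cube K) := {x : Cube K | ∑ i ∈ A with x i = false, v i = 0 ∨
      ∑ i ∈ A with x i = false, v i = ∑ i ∈ A, v i} with hG
  have hinj : #{κ : Fin K → Cube n | IsFake I v c A κ} ≤
      #(Fintype.piFinset fun p => if p ∈ R then C₁ else G) := by
    -- Transposing `κ` turns the points into `n` independent columns.
    refine card_le_card_of_injOn (fun κ p i => κ i p) (fun κ hκ => ?_) ?_
    · have hκ : IsFake I v c A κ := by simpa using hκ
      refine mem_coe.2 (Fintype.mem_piFinset.2 fun p => ?_)
      split_ifs with hp
      · obtain ⟨y, -, rfl⟩ := mem_map.1 hp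
        simp only [hC₁, mem_filter, mem_univ, true_and]
        exact fun i hi j hj => congrFun (hκ.1 i hi j hj) y
      · simp only [hG, mem_filter, mem_univ, true_and]
        exact hκ.2 p
    · intro κ _ κ' _ h
      funext i p
      exact congrFun (congrFun h p) i
  have hprod : #(Fintype.piFinset fun p => if p ∈ R then C₁ else G) = #C₁ ^ b * #G ^ (n - b) := by
    rw [Fintype.card_piFinset, prod_congr rfl fun p _ => apply_ite card (p ∈ R) C₁ G, prod_ite,
      prod_const, prod_const]
    congr 2
    · rw [← hR]; congr 1; ext; simp
    · rw [← hRc]; congr 1; ext; simp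
  have h1 := card_constant_le A
  have h2 := card_ratio_le A v hv hA
  calc _ ≤ #C₁ ^ b * #G ^ (n - b) * (2 ^ b) ^ #A * 4 ^ (n - b) := by
        rw [← hprod]; gcongr
    _ = (#C₁ * 2 ^ #A) ^ b * (4 * #G) ^ (n - b) := by
        rw [mul_pow, mul_pow, ← pow_mul, ← pow_mul, mul_comm b #A]; ring
    _ ≤ (2 * 2 ^ K) ^ b * (3 * 2 ^ K) ^ (n - b) := by gcongr
    _ = 2 ^ b * 3 ^ (n - b) * ((2 ^ K) ^ b * (2 ^ K) ^ (n - b)) := by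
        rw [mul_pow, mul_pow]; ring
    _ = _ := by
        rw [← pow_add, Nat.add_sub_cancel' hbn, ← pow_mul, ← pow_mul, mul_comm K n]

open Finset in
/-- The probability that some set of at least two points looks like a singleton. The sum over all
such sets is no larger than a constant times the number of bins, since a set of `a` points shares
a bin with probability `2^{-b (a - 1)}`. -/
theorem card_exists_isFake_le (I : Fin 3 → Fin b ↪ Fin n) (v : Fin K → ℝ) (hv : ∀ i, v i ≠ 0)
    (hK : K ≤ 2 ^ b)
    [DecidablePred fun κ : Fin K → Cube n => ∃ c, ∃ A : Finset (Fin K), 2 ≤ #A ∧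
      IsFake I v c A κ] :
    (#{κ : Fin K → Cube n | ∃ c, ∃ A : Finset (Fin K), 2 ≤ #A ∧
      IsFake I v c A κ} : ℝ) ≤
      9 * 2 ^ b * (3 / 4) ^ (n - b) * (2 ^ n) ^ K := by
  classical
  let P : Finset (Finset (Fin K)) := univ.filter fun A => 2 ≤ #A
  have hA : ∀ c, ∀ A ∈ P, (#{κ : Fin K → Cube n | IsFake I v c A κ} : ℝ) ≤
      2 ^ b * (3 / 4) ^ (n - b) * (2 ^ n) ^ K * (1 / 2 ^ b) ^ #A := by
    intro c A hAP
    have h := card_isFake_le I v hv c A (mem_filter.1 hAP).2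
    have h' : (#{κ : Fin K → Cube n | IsFake I v c A κ} : ℝ) * (2 ^ b) ^ #A * 4 ^ (n - b) ≤
      2 ^ b * 3 ^ (n - b) * (2 ^ n) ^ K := by exact_mod_cast h
    rw [← le_div_iff₀ (by positivity), ← le_div_iff₀ (by positivity)] at h'
    refine h'.trans (le_of_eq ?_)
    rw [div_pow, div_pow, one_pow]
    field_simp
  have hsub : ({κ : Fin K → Cube n | ∃ c, ∃ A : Finset (Fin K), 2 ≤ #A ∧
      IsFake I v c A κ} : Finset _) ⊆
      ((univ : Finset (Fin 3)) ×ˢ P).biUnion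
        fun w => {κ : Fin K → Cube n | IsFake I v w.1 w.2 κ} := by
    intro κ hκ
    obtain ⟨c, A, h1, h2⟩ := (mem_filter.1 hκ).2
    refine mem_biUnion.2 ⟨(c, A), ?_, by simpa using h2⟩
    simp only [P, mem_product, mem_univ, true_and, mem_filter]
    exact h1
  have hexp : (1 / 2 ^ b + 1 : ℝ) ^ K ≤ 3 := by
    calc (1 / 2 ^ b + 1 : ℝ) ^ K ≤ Real.exp (1 / 2 ^ b) ^ K := by
          gcongr
          exact Real.add_one_le_exp _
      _ = Real.exp (K * (1 / 2 ^ b)) := by rw [← Real.exp_nat_mul]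
      _ ≤ Real.exp 1 := by
          gcongr
          rw [mul_one_div, div_le_one (by positivity)]
          exact_mod_cast hK
      _ ≤ 3 := Real.exp_one_lt_three.le
  calc (#{κ : Fin K → Cube n | ∃ c, ∃ A : Finset (Fin K), 2 ≤ #A ∧
      IsFake I v c A κ} : ℝ)
      ≤ ∑ w ∈ (univ : Finset (Fin 3)) ×ˢ P, (#{κ : Fin K → Cube n | IsFake I v w.1 w.2 κ} : ℝ) := by
        exact_mod_cast (card_le_card hsub).trans card_biUnion_le
    _ ≤ ∑ w ∈ (univ : Finset (Fin 3)) ×ˢ P,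
          2 ^ b * (3 / 4) ^ (n - b) * (2 ^ n) ^ K * (1 / 2 ^ b : ℝ) ^ #w.2 :=
        sum_le_sum fun w hw => hA w.1 w.2 (mem_product.1 hw).2
    _ = 3 * (2 ^ b * (3 / 4) ^ (n - b) * (2 ^ n) ^ K * ∑ A ∈ P, (1 / 2 ^ b : ℝ) ^ #A) := by
        rw [sum_product]
        simp only [sum_const, card_univ, Fintype.card_fin, nsmul_eq_mul, mul_sum]
        norm_num
    _ ≤ 3 * (2 ^ b * (3 / 4) ^ (n - b) * (2 ^ n) ^ K * 3) := by
        gcongr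
        refine le_trans ?_ hexp
        rw [← Fin.sum_pow_mul_eq_add_pow]
        simp only [one_pow, mul_one]
        exact sum_le_sum_of_subset_of_nonneg (filter_subset _ _) fun A _ _ => by positivity
    _ = _ := by ring

open Finset in
/-- If at most a fraction `ε` of all `K`-tuples is bad, then at most a fraction `2 ε` of the tuples
of distinct points is: at least half of all tuples have distinct entries. -/
theorem one_sub_le_prob {E : (Fin K ↪ Cube n) → Prop} {Bad : (Fin K → Cube n) → Prop}
    [DecidablePred Bad] {ε : ℝ} (hBad : (#{κ : Fin K → Cube n | Bad κ} : ℝ) ≤ ε * (2 ^ n) ^ K)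
    (hE : ∀ κ : Fin K ↪ Cube n, ¬ Bad κ → E κ) (hK : 2 * K ^ 2 ≤ 2 ^ n) :
    1 - 2 * ε ≤ prob E := by
  classical
  have htot : (Nat.card (Fin K ↪ Cube n) : ℝ) = (2 ^ n).descFactorial K := by
    rw [Nat.card_eq_fintype_card, Fintype.card_embedding_eq]
    simp
  have hKn : K ≤ 2 ^ n := by nlinarith
  have hN : (0 : ℝ) < 2 ^ n := by positivity
  have hK' : 2 * (K : ℝ) ^ 2 ≤ 2 ^ n := by exact_mod_cast hK
  have hhalf : ((2 : ℝ) ^ n) ^ K / 2 ≤ (2 ^ n).descFactorial K := by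
    have h1 : (((2 ^ n + 1 - K : ℕ) : ℝ)) ^ K ≤ (2 ^ n).descFactorial K := by
      exact_mod_cast Nat.pow_sub_le_descFactorial (2 ^ n) K
    refine le_trans ?_ h1
    rw [Nat.cast_sub (by omega)]
    push_cast
    have hb := one_add_mul_le_pow (a := -((K : ℝ) / 2 ^ n)) (by
      have : (K : ℝ) / 2 ^ n ≤ 1 := by
        rw [div_le_one hN]; exact_mod_cast hKn
      linarith) K
    have h2 : (1 : ℝ) / 2 ≤ 1 + K * -((K : ℝ) / 2 ^ n) := by
      have : (K : ℝ) * (K / 2 ^ n) ≤ 1 / 2 := by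
        rw [← mul_div_assoc, div_le_iff₀ hN]
        nlinarith
      linarith
    calc ((2 : ℝ) ^ n) ^ K / 2 = (1 / 2) * (2 ^ n) ^ K := by ring
      _ ≤ (1 + -((K : ℝ) / 2 ^ n)) ^ K * (2 ^ n) ^ K := by gcongr; exact h2.trans hb
      _ = (2 ^ n - K : ℝ) ^ K := by
        rw [← mul_pow]; congr 1; field_simp; ring
      _ ≤ (2 ^ n + 1 - K : ℝ) ^ K := by
        gcongr
        · have : (K : ℝ) ≤ 2 ^ n := by exact_mod_cast hKn
          linarith
        · linarith
  have hcompl : (Nat.card (Fin K ↪ Cube n) : ℝ) ≤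
      Nat.card {κ : Fin K ↪ Cube n // E κ} + ε * (2 ^ n) ^ K := by
    refine le_trans ?_ (add_le_add_right hBad _)
    rw [Nat.card_eq_fintype_card, Nat.card_eq_fintype_card, Fintype.card_subtype, ← card_univ,
      ← card_filter_add_card_filter_not (s := univ) E, Nat.cast_add]
    gcongr
    refine card_le_card_of_injOn (fun κ => ⇑κ) (fun κ hκ => ?_) DFunLike.coe_injective.injOn
    simp only [coe_filter, mem_univ, true_and, Set.mem_ofPred_eq] at hκ ⊢
    by_contra h
    exact hκ (hE κ h)
  have hpos : (0 : ℝ) < Nat.card (Fin K ↪ Cube n) := by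
    rw [htot]
    exact lt_of_lt_of_le (by positivity) hhalf
  have hε : 0 ≤ ε := by
    by_contra! h
    have h1 : ε * (2 ^ n) ^ K < 0 := mul_neg_of_neg_of_pos h (by positivity)
    have h2 : (0 : ℝ) ≤ #{κ : Fin K → Cube n | Bad κ} := by positivity
    linarith
  rw [prob, le_div_iff₀ hpos]
  rw [← htot] at hhalf
  nlinarith

end

/-! ### Recovery, and the choice of parameters -/

section

variable {n b K : ℕ}

theorem unambiguous_of_noCancellation (I : Fin 3 → Fin b → Fin n) {f : Cube n → ℝ}
    (hf : NoCancellation f) : Unambiguous I (mobius f) := by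
  classical
  intro c A hA hne _
  obtain ⟨k, hk, l, hl, hkl⟩ := Finset.one_lt_card.1 hA
  obtain ⟨p, hp⟩ := Function.ne_iff.1 hkl
  have hsplit := Finset.sum_filter_add_sum_filter_not A (fun k => k p = false) (mobius f)
  have hboth : (∃ k ∈ A, k p = false) ∧ ∃ k ∈ A, ¬ k p = false := by
    rcases h : k p with _ | _
    · exact ⟨⟨k, hk, h⟩, l, hl, fun h' => hp (h.trans h'.symm)⟩
    · refine ⟨⟨l, hl, ?_⟩, k, hk, by simp [h]⟩
      rw [h] at hp
      simpa using hp.symm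
  have h1 := hf (A.filter fun k => k p = false) (Finset.filter_nonempty_iff.2 hboth.1)
    fun k hk => hne k (Finset.mem_filter.1 hk).1
  have h2 := hf (A.filter fun k => ¬ k p = false) (Finset.filter_nonempty_iff.2 hboth.2)
    fun k hk => hne k (Finset.mem_filter.1 hk).1
  exact ⟨p, h1, fun h => h2 (by linarith)⟩

theorem unambiguous_of_not_isFake (I : Fin 3 → Fin b ↪ Fin n) {F : Cube n → ℝ} {v : Fin K → ℝ}
    (κ : Fin K ↪ Cube n) (hF : ∀ k, F k ≠ 0 → k ∈ Set.range κ) (hv : ∀ i, F (κ i) = v i)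
    (h : ¬ ∃ c, ∃ A : Finset (Fin K), 2 ≤ A.card ∧ IsFake I v c A κ) :
    Unambiguous (fun c => I c) F := by
  classical
  intro c A hA hne hbin
  by_contra! hp
  have hmap : A = (Finset.univ.filter fun i => κ i ∈ A).map κ := by
    ext k
    simp only [Finset.mem_map, Finset.mem_filter, Finset.mem_univ, true_and]
    constructor
    · intro hk
      obtain ⟨i, rfl⟩ := hF k (hne k hk)
      exact ⟨i, hk, rfl⟩
    · rintro ⟨i, hi, rfl⟩
      exact hi
  refine h ⟨c, Finset.univ.filter fun i => κ i ∈ A, ?_, fun i hi j hj => ?_, fun p => ?_⟩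
  · rwa [hmap, Finset.card_map] at hA
  · exact hbin _ (Finset.mem_filter.1 hi).2 _ (Finset.mem_filter.1 hj).2
  · have := hp p
    rw [hmap, Finset.filter_map, Finset.sum_map, Finset.sum_map] at this
    simp only [hv] at this
    rw [or_iff_not_imp_left]
    exact this

theorem peelable_of_not_isCore (I : Fin 3 → Fin b ↪ Fin n) {F : Cube n → ℝ}
    (κ : Fin K ↪ Cube n) (hF : ∀ k, F k ≠ 0 → k ∈ Set.range κ)
    (h : ¬ ∃ A : Finset (Fin K), A.Nonempty ∧ IsCore I A κ) :
    Peelable (fun c => I c) F := by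
  classical
  intro A hA hne
  by_contra! hp
  refine h ⟨Finset.univ.filter fun i => κ i ∈ A, ?_, fun c i hi => ?_⟩
  · obtain ⟨k, hk⟩ := hA
    obtain ⟨i, rfl⟩ := hF k (hne k hk)
    exact ⟨i, by simpa using hk⟩
  · obtain ⟨l, hl, h1, h2⟩ := hp c (κ i) (Finset.mem_filter.1 hi).2
    obtain ⟨j, rfl⟩ := hF l (hne l hl)
    exact ⟨j, by simpa using hl, fun hji => h2 (congrArg κ hji), h1⟩

/-- The bounds of `Ends.smt` in terms of `K` and `n` alone, for at most `η K` bins in each group. -/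
theorem recovers_of_peelable (I : Fin 3 → Fin b ↪ Fin n) {f : Cube n → ℝ} {η : ℝ} (hn : 1 ≤ n)
    (κ : Fin K ↪ Cube n) (hκ : ∀ k, mobius f k ≠ 0 ↔ k ∈ Set.range κ)
    (hF : Unambiguous (fun c => I c) (mobius f)) (hP : Peelable (fun c => I c) (mobius f))
    (hb : (2 : ℝ) ^ b ≤ η * K) :
    Recovers I f (4000 * (η + 1) * (K * n)) (4000 * (η + 1) * (K * n ^ 2)) := by
  classical
  have hbn : b ≤ n := by simpa using Fintype.card_le_of_embedding (I 0)
  have hcard : (Finset.univ.filter fun k => mobius f k ≠ 0).card = K := by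
    have : (Finset.univ.filter fun k => mobius f k ≠ 0) = Finset.univ.map κ := by
      ext k
      simp [hκ]
    rw [this, Finset.card_map, Finset.card_univ, Fintype.card_fin]
  obtain ⟨h1, h2, h3⟩ := Ends.smt hbn hF hP K hcard
  refine ⟨K + 1, h1, ?_, ?_⟩
  all_goals
    have hn' : (1 : ℝ) ≤ n := by exact_mod_cast hn
    have hηK : 0 ≤ η * K := le_trans (by positivity) hb
    have hsum : (2 : ℝ) ^ b + K ≤ (η + 1) * K := by linarith
  · calc _ ≤ ((3 * ((n + 1) * 2 ^ b) : ℕ) : ℝ) := by exact_mod_cast h3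
      _ = 3 * ((n + 1) * 2 ^ b) := by push_cast; ring
      _ ≤ 3 * ((n + n) * (2 ^ b + K)) := by gcongr; linarith [(Nat.cast_nonneg K : (0 : ℝ) ≤ K)]
      _ ≤ 3 * ((n + n) * ((η + 1) * K)) := by gcongr
      _ = 6 * ((η + 1) * K) * n := by ring
      _ ≤ 4000 * ((η + 1) * K) * n := by
        have : 0 ≤ (η + 1) * K := le_trans (by positivity) hsum
        gcongr
        norm_num
      _ = _ := by ring
  · calc _ ≤ ((1000 * (n + 1) ^ 2 * (2 ^ b + K) : ℕ) : ℝ) := by exact_mod_cast h2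
      _ = 1000 * (n + 1) ^ 2 * (2 ^ b + K) := by push_cast; ring
      _ ≤ 1000 * (n + n) ^ 2 * ((η + 1) * K) := by gcongr
      _ = _ := by ring

/-- Below the threshold, every admissible `K` is at most `2^{n/3} / 36` once `n` is large. -/
theorem exists_forall_cube_le {δ B : ℝ} (hδ : δ ≤ 1 / 3) (hB : δ = 1 / 3 → B ≤ 1 / 36) :
    ∃ n₀ : ℕ, ∀ n K : ℕ, n₀ ≤ n → (K : ℝ) ≤ B * (2 : ℝ) ^ ((n : ℝ) * δ) →
      (36 * K) ^ 3 ≤ 2 ^ n := by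
  have main : ∃ n₀ : ℕ, ∀ n : ℕ, n₀ ≤ n →
      36 * (B * (2 : ℝ) ^ ((n : ℝ) * δ)) ≤ (2 : ℝ) ^ ((n : ℝ) * (1 / 3)) := by
    rcases hδ.lt_or_eq with h | h
    · have ht : Filter.Tendsto (fun n : ℕ => (2 : ℝ) ^ ((n : ℝ) * (1 / 3 - δ))) Filter.atTop
          Filter.atTop := by
        have h1 : (1 : ℝ) < 2 ^ (1 / 3 - δ) := Real.one_lt_rpow (by norm_num) (by linarith)
        refine (tendsto_pow_atTop_atTop_of_one_lt h1).congr fun n => ?_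
        rw [← Real.rpow_natCast, ← Real.rpow_mul (by norm_num), mul_comm]
      obtain ⟨n₀, hn₀⟩ := Filter.eventually_atTop.1 (ht.eventually_ge_atTop (36 * B))
      refine ⟨n₀, fun n hn => ?_⟩
      calc 36 * (B * (2 : ℝ) ^ ((n : ℝ) * δ)) = 36 * B * (2 : ℝ) ^ ((n : ℝ) * δ) := by ring
        _ ≤ (2 : ℝ) ^ ((n : ℝ) * (1 / 3 - δ)) * (2 : ℝ) ^ ((n : ℝ) * δ) := by
          gcongr
          exact hn₀ n hn
        _ = _ := by rw [← Real.rpow_add (by norm_num)]; congr 1; ring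
    · refine ⟨0, fun n _ => ?_⟩
      rw [h]
      have := hB h
      have h2 : (0 : ℝ) < 2 ^ ((n : ℝ) * (1 / 3)) := by positivity
      nlinarith
  obtain ⟨n₀, hn₀⟩ := main
  refine ⟨n₀, fun n K hn hK => ?_⟩
  have h1 : 36 * (K : ℝ) ≤ (2 : ℝ) ^ ((n : ℝ) * (1 / 3)) := by linarith [hn₀ n hn]
  have h2 : (36 * (K : ℝ)) ^ 3 ≤ ((2 : ℝ) ^ ((n : ℝ) * (1 / 3))) ^ 3 := by gcongr
  rw [← Real.rpow_mul_natCast (by norm_num)] at h2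
  have h3 : (n : ℝ) * (1 / 3) * ((3 : ℕ) : ℝ) = n := by push_cast; ring
  rw [h3, Real.rpow_natCast] at h2
  exact_mod_cast h2

/-- For `δ ≤ 1/6`, the `O(K)` expected sets that share a bin are outweighed by the probability
`(3/4)^{n-b}` that such a set looks like a singleton; this holds because
`2^{29} 3^{72} < 4^{72}`. -/
theorem exists_forall_fake_bound {δ B η : ℝ} (hδ : δ ≤ 1 / 6) :
    ∃ n₀ : ℕ, ∀ n K b : ℕ, n₀ ≤ n → b ≤ n → (K : ℝ) ≤ B * (2 : ℝ) ^ ((n : ℝ) * δ) →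
      (2 : ℝ) ^ b ≤ η * K → (K : ℝ) * (2 ^ b * (3 / 4) ^ (n - b)) ≤ 1 := by
  have ht : Filter.Tendsto (fun n : ℕ => η ^ 102 * B ^ 174 * (2 ^ 29 * (3 / 4) ^ 72 : ℝ) ^ n)
      Filter.atTop (nhds (η ^ 102 * B ^ 174 * 0)) :=
    (tendsto_pow_atTop_nhds_zero_of_lt_one (by positivity) (by norm_num)).const_mul _
  rw [mul_zero] at ht
  obtain ⟨n₀, hn₀⟩ := Filter.eventually_atTop.1 (ht.eventually_le_const (zero_lt_one (α := ℝ)))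
  refine ⟨n₀, fun n K b hn hbn hK hb => ?_⟩
  have hK6 : (K : ℝ) ^ 6 ≤ B ^ 6 * 2 ^ n := by
    have h1 : (2 : ℝ) ^ ((n : ℝ) * δ) ≤ 2 ^ ((n : ℝ) * (1 / 6)) := by
      gcongr
      norm_num
    calc (K : ℝ) ^ 6 ≤ (B * (2 : ℝ) ^ ((n : ℝ) * δ)) ^ 6 := by gcongr
      _ = B ^ 6 * ((2 : ℝ) ^ ((n : ℝ) * δ)) ^ 6 := by rw [mul_pow]
      _ ≤ B ^ 6 * ((2 : ℝ) ^ ((n : ℝ) * (1 / 6))) ^ 6 := by gcongr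
      _ = B ^ 6 * 2 ^ n := by
        rw [← Real.rpow_mul_natCast (by norm_num)]
        have : (n : ℝ) * (1 / 6) * ((6 : ℕ) : ℝ) = n := by push_cast; ring
        rw [this, Real.rpow_natCast]
  have hthree : ((3 : ℝ) / 4) ^ (n - b) * (3 / 4) ^ b = (3 / 4) ^ n := by
    rw [← pow_add, Nat.sub_add_cancel hbn]
  -- `(4/3)^12 ≤ 2^5` turns the loss of `b` coordinates into a power of `2^b`.
  have h12 : (((3 : ℝ) / 4) ^ (n - b)) ^ 12 ≤ (2 ^ b) ^ 5 * ((3 / 4) ^ n) ^ 12 := by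
    rw [← hthree, mul_pow]
    have h1 : (1 : ℝ) ≤ (2 ^ b) ^ 5 * ((3 / 4) ^ b) ^ 12 := by
      rw [← pow_mul, ← pow_mul, mul_comm b 5, mul_comm b 12, pow_mul, pow_mul, ← mul_pow]
      exact one_le_pow₀ (by norm_num)
    calc (((3 : ℝ) / 4) ^ (n - b)) ^ 12 = 1 * (((3 : ℝ) / 4) ^ (n - b)) ^ 12 := by ring
      _ ≤ ((2 ^ b) ^ 5 * ((3 / 4) ^ b) ^ 12) * (((3 : ℝ) / 4) ^ (n - b)) ^ 12 := by gcongr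
      _ = _ := by ring
  rw [← pow_le_one_iff_of_nonneg (n := 72) (by positivity) (by norm_num)]
  calc ((K : ℝ) * (2 ^ b * (3 / 4) ^ (n - b))) ^ 72
      = K ^ 72 * (2 ^ b) ^ 72 * ((((3 : ℝ) / 4) ^ (n - b)) ^ 12) ^ 6 := by ring
    _ ≤ (K : ℝ) ^ 72 * (2 ^ b) ^ 72 * ((2 ^ b) ^ 5 * ((3 / 4) ^ n) ^ 12) ^ 6 := by gcongr
    _ = (K : ℝ) ^ 72 * (2 ^ b) ^ 102 * ((3 / 4) ^ n) ^ 72 := by ring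
    _ ≤ (K : ℝ) ^ 72 * (η * K) ^ 102 * ((3 / 4) ^ n) ^ 72 := by gcongr
    _ = η ^ 102 * (K ^ 6) ^ 29 * ((3 / 4) ^ n) ^ 72 := by ring
    _ ≤ η ^ 102 * (B ^ 6 * 2 ^ n) ^ 29 * ((3 / 4) ^ n) ^ 72 := by
        have : 0 ≤ η ^ 102 := Even.pow_nonneg (by decide) η
        gcongr
    _ = η ^ 102 * B ^ 174 * (2 ^ 29 * (3 / 4) ^ 72) ^ n := by
        rw [mul_pow (2 ^ 29 : ℝ), ← pow_mul (2 : ℝ) 29, ← pow_mul (3 / 4 : ℝ) 72, mul_comm 29 n,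
          mul_comm 72 n, pow_mul, pow_mul, mul_pow, ← pow_mul B]
        ring
    _ ≤ 1 := hn₀ n hn

end

end SparseMobius

end

theorem theorem1 :
    ∃ η₀ : ℝ, 0 < η₀ ∧ ∃ B₀ : ℝ, 0 < B₀ ∧ ∀ η₁ : ℝ, 2 * η₀ ≤ η₁ → ∃ c : ℝ, 0 < c ∧
      ∀ δ B : ℝ, δ ≤ 1 / 3 → (δ = 1 / 3 → B ≤ B₀) →
        ∃ n₀ : ℕ, ∀ n K : ℕ, n₀ ≤ n → 1 ≤ K → (K : ℝ) ≤ B * (2 : ℝ) ^ ((n : ℝ) * δ) →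
          (∃ b : ℕ, η₀ * K ≤ (2 : ℝ) ^ b ∧ (2 : ℝ) ^ b ≤ η₁ * K ∧ 3 * b ≤ n) ∧
          ∀ b : ℕ, η₀ * K ≤ (2 : ℝ) ^ b → (2 : ℝ) ^ b ≤ η₁ * K →
            ∀ I : Fin 3 → Fin b ↪ Fin n,
              (∀ c₁ c₂, c₁ ≠ c₂ → Disjoint (Set.range (I c₁)) (Set.range (I c₂))) →
              1 - c / K ≤ SparseMobius.prob (fun κ : Fin K ↪ SparseMobius.Cube n =>
                ∀ f : SparseMobius.Cube n → ℝ,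
                  (∀ k, SparseMobius.mobius f k ≠ 0 ↔ k ∈ Set.range κ) →
                  SparseMobius.NoCancellation f →
                  SparseMobius.Recovers I f (c * (K * n)) (c * (K * n ^ 2))) ∧
              (δ ≤ 1 / 6 → ∀ v : Fin K → ℝ, (∀ i, v i ≠ 0) →
                1 - c / K ≤ SparseMobius.prob (fun κ : Fin K ↪ SparseMobius.Cube n =>
                  ∀ f : SparseMobius.Cube n → ℝ,
                    (∀ i, SparseMobius.mobius f (κ i) = v i) →
                    (∀ k, k ∉ Set.range κ → SparseMobius.mobius f k = 0) →
                    SparseMobius.Recovers I f (c * (K * n)) (c * (K * n ^ 2)))) := by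
  classical
  -- `18 K ≤ 2^b` bounds the cores by a geometric series; `K ≤ 2^{n/3} / 36` leaves room for three
  -- blocks of `b` coordinates, where `2^b` is the first power of two that is at least `18 K`.
  refine ⟨18, by norm_num, 1 / 36, by norm_num, fun η₁ hη => ⟨4000 * (η₁ + 1), by linarith,
    fun δ B hδ hB => ?_⟩⟩
  obtain ⟨n₁, hn₁⟩ := SparseMobius.exists_forall_cube_le hδ hB
  obtain ⟨n₂, hn₂⟩ : ∃ n₂ : ℕ, δ ≤ 1 / 6 → ∀ n K b : ℕ, n₂ ≤ n → b ≤ n →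
      (K : ℝ) ≤ B * (2 : ℝ) ^ ((n : ℝ) * δ) → (2 : ℝ) ^ b ≤ η₁ * K →
      (K : ℝ) * (2 ^ b * (3 / 4) ^ (n - b)) ≤ 1 := by
    by_cases h : δ ≤ 1 / 6
    · obtain ⟨n₂, hn₂⟩ := SparseMobius.exists_forall_fake_bound (B := B) (η := η₁) h
      exact ⟨n₂, fun _ => hn₂⟩
    · exact ⟨0, fun h' => absurd h' h⟩
  refine ⟨max (max n₁ n₂) 1, fun n K hn hK hKB => ?_⟩
  simp only [max_le_iff] at hn
  have hcube : (36 * K) ^ 3 ≤ 2 ^ n := hn₁ n K hn.1.1 hKB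
  have hsq : 2 * K ^ 2 ≤ 2 ^ n := by
    refine le_trans ?_ hcube
    calc 2 * K ^ 2 ≤ 36 ^ 3 * K ^ 3 := Nat.mul_le_mul (by norm_num)
          (Nat.pow_le_pow_right hK (by norm_num))
      _ = _ := by ring
  have hK0 : (0 : ℝ) < K := by exact_mod_cast hK
  refine ⟨?_, fun b hb₀ hb₁ I hI => ?_⟩
  · have h1 : 18 * K ≤ 2 ^ Nat.clog 2 (18 * K) := Nat.le_pow_clog (by norm_num) _
    have h2 : 2 ^ Nat.clog 2 (18 * K) ≤ 36 * K := by
      have h3 := Nat.pow_pred_clog_lt_self (b := 2) (by norm_num) (x := 18 * K) (by omega)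
      have h4 : 0 < Nat.clog 2 (18 * K) := Nat.clog_pos (by norm_num) (by omega)
      obtain ⟨m, hm⟩ := Nat.exists_eq_succ_of_ne_zero h4.ne'
      rw [hm] at h3 ⊢
      simp only [Nat.pred_succ] at h3
      rw [pow_succ]
      omega
    refine ⟨Nat.clog 2 (18 * K), by exact_mod_cast h1, ?_, ?_⟩
    · have h2' : (2 : ℝ) ^ Nat.clog 2 (18 * K) ≤ 36 * K := by exact_mod_cast h2
      nlinarith
    · rw [mul_comm, ← Nat.pow_le_pow_iff_right (a := 2) (by norm_num), pow_mul]
      exact (Nat.pow_le_pow_left h2 3).trans hcube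
  have hM : 18 * K ≤ 2 ^ b := by exact_mod_cast hb₀
  have hbn : b ≤ n := by simpa using Fintype.card_le_of_embedding (I 0)
  have hcore := SparseMobius.card_exists_isCore_le I hI hK hM
  refine ⟨?_, fun hδ6 v hv => ?_⟩
  · refine le_trans ?_ (SparseMobius.one_sub_le_prob hcore (fun κ hκ f hf hNC => ?_) hsq)
    · have : 2 * (1 / (18 * (K : ℝ))) ≤ 4000 * (η₁ + 1) / K := by
        rw [mul_one_div, ← div_div]
        gcongr
        linarith
      linarith
    · exact SparseMobius.recovers_of_peelable I hn.2 κ hf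
        (SparseMobius.unambiguous_of_noCancellation _ hNC)
        (SparseMobius.peelable_of_not_isCore I κ (fun k => (hf k).1) hκ) hb₁
  · have hfake := SparseMobius.card_exists_isFake_le I v hv (by omega)
    have hboth : ((Finset.univ.filter fun κ : Fin K → SparseMobius.Cube n =>
        (∃ A : Finset (Fin K), A.Nonempty ∧ SparseMobius.IsCore I A κ) ∨
        ∃ c, ∃ A : Finset (Fin K), 2 ≤ A.card ∧ SparseMobius.IsFake I v c A κ).card : ℝ) ≤
        (1 / (18 * K) + 9 * 2 ^ b * (3 / 4) ^ (n - b)) * (2 ^ n) ^ K := by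
      rw [Finset.filter_or, add_mul]
      refine le_trans ?_ (add_le_add hcore hfake)
      exact_mod_cast Finset.card_union_le _ _
    refine le_trans ?_ (SparseMobius.one_sub_le_prob hboth (fun κ hκ f hf hf0 => ?_) hsq)
    · have hsmall : (2 : ℝ) ^ b * (3 / 4) ^ (n - b) ≤ 1 / K := by
        rw [le_div_iff₀ hK0, mul_comm]
        exact hn₂ hδ6 n K b hn.1.2 hbn hKB hb₁
      have h1 : 1 / (18 * (K : ℝ)) ≤ 1 / K := by
        gcongr
        linarith
      have h2 : 20 * (1 / (K : ℝ)) ≤ 4000 * (η₁ + 1) / K := by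
        rw [mul_one_div]
        gcongr
        linarith
      nlinarith
    · rw [not_or] at hκ
      have hrange : ∀ k, SparseMobius.mobius f k ≠ 0 ↔ k ∈ Set.range κ := by
        refine fun k => ⟨fun h => ?_, ?_⟩
        · by_contra hk
          exact h (hf0 k hk)
        · rintro ⟨i, rfl⟩
          rw [hf i]
          exact hv i
      exact SparseMobius.recovers_of_peelable I hn.2 κ hrange
        (SparseMobius.unambiguous_of_not_isFake I κ (fun k => (hrange k).1) hf hκ.2)
        (SparseMobius.peelable_of_not_isCore I κ (fun k => (hrange k).1) hκ.1) hb₁
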